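/- **Setting.** Let $\pi(dx)=\pi(x)\,dx$ be a probability distribution on $\mathbb R^p$ whose density vanishes outside a set $S$, let $\Gamma=[c,C]$, let $\mathcal T\subset(0,\infty)$ be bounded, and let $r>0$ be a function that is continuous and positive on $S$ (for example $r\equiv 1$). For $t\in\mathcal T\cup\{1\}$ let $\pi_t$ be the probability density proportional to $\pi(x)^t r(x)^{1-t}$; thus $\pi_1=\pi$. For $\gamma\in\Gamma^p$ and $x\in S$ let $q_\gamma(x,\cdot)$ be a probability density on $\mathbb R^p$ with $q_\gamma(x,y)=q_\gamma(y,x)$ for $x,y\in S$. Let $P_{\gamma,t}$ be the Metropolis kernel for $\pi_t$ with proposal density $q_\gamma$ and acceptance probability $\min(1,\pi_t(y)/\pi_t(x))$. **Algorithm.** The adaptive Parallel Tempering algorithm with $L\ge1$ levels, $\alpha_r\in(0,1]$, $\alpha\in(0,1)$, keeps at time $n$ positions $x^{(n)}_l\in S$, inverse temperatures $t^{(n)}_l=e^{\zeta^{(n)}_l}$ ($t_1=1$, $t_l^{(n)}\in\mathcal T$ for $l\geq 2$), proposal variances $\gamma_l^{(n)}\in\Gamma^p$, auxiliary means $\mu^{(n)}_l\in\mathbb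 R^p$, counters $c_l$ (initially $0$) and a number $L_n\le L$ of remaining levels ($L_0=L$). At time $n$, given the past: 1. With probability $\alpha_r$ (parallel step), each $x_l$, $l\le L_n$, is independently moved by $P_{\gamma_l^{(n)},t_l^{(n)}}$, and then, for each coordinate $j$, $\mu_{lj}^{(n+1)}=\mu_{lj}^{(n)}+b_n(x_{lj}^{(n+1)}-\mu_{lj}^{(n)})$ and $\gamma_{lj}^{(n+1)}=\gamma_{lj}^{(n)}+b_n\big((x_{lj}^{(n+1)}-\mu_{lj}^{(n+1)})^2-\gamma_{lj}^{(n)}\big)$. 2. Otherwise (exchange step), a pair $(l,l+1)$ with $l+1\le L_n$ is chosen with probability $\varsigma_l\ge 0$ (weights that depend only on $L_n$ and sum to $1$; if $L_n=1$ nothing happens), and $x_l,x_{l+1}$ are exchanged with probability $\min\Big(1,\frac{\pi_{t_l}(x_{l+1})\pi_{t_{l+1}}(x_l)}{\pi_{t_l}(x_l)\pi_{t_{l+1}}(x_{l+1})}\Big)$. Then $\zeta_{l+1}^{(n+1)}=\zeta_{l+1}^{(n)}-a_n^{l+1}(ER-\alpha)$, where $ER=1$ if the exchange was accepted and $ER=0$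 otherwise; if it was accepted, $\mu_k^{(n+1)}=x_k^{(n+1)}$ for $k=l,l+1$. 3. If $n\in\{m,2m,\dots\}$, then for each $l\le L_n$ the counter $c_l$ is increased by one if $\prod_j\gamma^{(n)}_{lj}\ge\prod_jV^{(n)}(x_{lj})$, where $V^{(n)}(x_{lj})$ is the sample variance of $x^{(0)}_{lj},\dots,x_{lj}^{(n)}$ with divisor $n+1$ (if this fails, $c_l$ is kept or reset to $0$). If $c_l\ge d$ for some $l\le L_n$, then $L_{n+1}$ is the smallest such $l$; otherwise $L_{n+1}=L_n$. Levels above the current number of levels are no longer simulated. All quantities not mentioned are kept. Whenever an update of $\gamma_{lj}$ or of $\zeta_{l}$ would leave $\Gamma$ or $\{z: e^z\in\mathcal T\}$, it is replaced by some value in this set that is no farther from the old value than the proposed one (e.g. a projection, or no change). The coefficients satisfy $b_n\ge0$, $b_n\to0$, and the $a_n^l$ are random variables with $a^l_n\to0$ almost surely. **Theorem.** Assume * (s1) $S$ is compact, and $\pi(x)$ is continuous and positive on $S$; * (s2) $(x,y,\gamma)\mapsto q_\gamma(x,y)$ is continuous and positive on $S^2\times\Gamma^p$. Then the algorithm is ergodic: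 for all initial values $x^{(0)}\in S^L$, $\gamma^{(0)}\in(\Gamma^{p})^L$, $t^{(0)}$ with $t_1^{(0)}=1$ and $t_l^{(0)}\in\mathcal T$ for $l\ge2$, and $\mu^{(0)}\in(\mathbb R^{p})^L$, $$\lim_{n\to\infty}\ \sup_{B}\big|\mathbb P[x_1^{(n)}\in B]-\pi(B)\big|=0,$$ where the supremum is over the Borel sets $B\subseteq\mathbb R^p$. -/

import Mathlib

open MeasureTheory ProbabilityTheory Filter Topology

noncomputable section

namespace AdaptivePT

/-- The Euclidean space on which each of the parallel chains lives. -/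
abbrev E (p : ℕ) : Type := EuclideanSpace ℝ (Fin p)

/-- Outcome of one iteration: a parallel (Metropolis) step; an exchange step in which the pair
formed by level `i` and the next level is chosen, with the information whether the exchange was
accepted; or an exchange step that finds no pair to choose from (a single level is left). -/
inductive Move (L : ℕ) : Type where
  | parallel : Move L
  | exchange (i : Fin L) (accepted : Bool) : Move L
  | idle : Move L

instance (L : ℕ) : MeasurableSpace (Move L) := ⊤

/-- The deterministic data of the algorithm, with at most `L` levels on `ℝ^p`. Level `0` carries
the target distribution. The structure holds data only, no property. -/
structure Spec (p L : ℕ) where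
  /-- support of the target -/
  S : Set (E p)
  /-- density of the target -/
  dens : E p → ℝ
  /-- reference function at infinite temperature (`1` if one tempers by plain powers) -/
  ref : E p → ℝ
  /-- proposal density `y ↦ q γ x y` with variance vector `γ` -/
  q : (Fin p → ℝ) → E p → E p → ℝ
  /-- lower end of the range of the proposal variances -/
  c : ℝ
  /-- upper end of the range of the proposal variances -/
  C : ℝ
  /-- range of the inverse temperatures -/
  T : Set ℝ
  /-- probability of the parallel step -/
  αr : ℝ
  /-- desired exchange ratio -/
  α : ℝ
  /-- `w N i`: probability to choose the pair of the levels `i`, `i + 1` if `N` levels are left -/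
  w : ℕ → Fin L → ℝ
  /-- learning coefficients of the proposal parameters -/
  b : ℕ → ℝ
  /-- number of iterations between two decisions about the number of levels -/
  m : ℕ
  /-- number of positive checks after which a level counts as flat -/
  d : ℕ

/-- The level after `i` (the last level is sent to itself; it never starts a chosen pair). -/
def next {L : ℕ} (i : Fin L) : Fin L := if h : i.val + 1 < L then ⟨i.val + 1, h⟩ else i

namespace Spec

variable {p L : ℕ} (A : Spec p L)

/-- The target distribution. -/
def target : Measure (E p) := volume.withDensity fun x => ENNReal.ofReal (A.dens x)

/-- Normalised density of the tempered distribution,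
proportional to `dens ^ t * ref ^ (1 - t)`. -/
def tempered (t : ℝ) (x : E p) : ℝ :=
  A.dens x ^ t * A.ref x ^ (1 - t) / ∫ y, A.dens y ^ t * A.ref y ^ (1 - t)

/-- Metropolis acceptance probability for a move from `x` to `y`. -/
def accept (t : ℝ) (x y : E p) : ℝ := min 1 (A.tempered t y / A.tempered t x)

/-- Metropolis transition probability from `x` for the tempered distribution. -/
def metropolis (γ : Fin p → ℝ) (t : ℝ) (x : E p) : Measure (E p) :=
  volume.withDensity (fun y => ENNReal.ofReal (A.q γ x y * A.accept t x y)) +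
    (∫⁻ y, ENNReal.ofReal (A.q γ x y * (1 - A.accept t x y))) • Measure.dirac x

/-- Acceptance probability of the exchange of the levels `i` and `next i`. -/
def exchangeProb (t : Fin L → ℝ) (x : Fin L → E p) (i : Fin L) : ℝ :=
  min 1 (A.tempered (t i) (x (next i)) * A.tempered (t (next i)) (x i) /
    (A.tempered (t i) (x i) * A.tempered (t (next i)) (x (next i))))

open Classical in
/-- Law of the parallel step: the remaining `N` levels move independently by their Metropolis
transitions; removed levels are no longer simulated. -/
def parallelLaw (N : ℕ) (γ : Fin L → Fin p → ℝ) (t : Fin L → ℝ) (x : Fin L → E p) :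
    Measure (Fin L → E p) :=
  Measure.pi fun l => if l.val < N then A.metropolis (γ l) (t l) (x l) else Measure.dirac (x l)

/-- Joint law of the outcome of an iteration and of the new position, given that `N` levels are
left, with proposal variances `γ`, inverse temperatures `t` and current position `x`. -/
def stepLaw (N : ℕ) (γ : Fin L → Fin p → ℝ) (t : Fin L → ℝ) (x : Fin L → E p) :
    Measure (Move L × (Fin L → E p)) :=
  ENNReal.ofReal A.αr • (A.parallelLaw N γ t x).map (fun y => (Move.parallel, y)) +
    ENNReal.ofReal (1 - A.αr) •
      ((∑ i : Fin L, ENNReal.ofReal (A.w N i) •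
          (ENNReal.ofReal (A.exchangeProb t x i) •
              Measure.dirac (Move.exchange i true, x ∘ Equiv.swap i (next i)) +
            ENNReal.ofReal (1 - A.exchangeProb t x i) •
              Measure.dirac (Move.exchange i false, x))) +
        ENNReal.ofReal (1 - ∑ i : Fin L, A.w N i) • Measure.dirac (Move.idle, x))

/-- The box `Γ^p` with `Γ = [c, C]` of admissible proposal variances. -/
def varBox : Set (Fin p → ℝ) := Set.univ.pi fun _ => Set.Icc A.c A.C

/-- The conventions under which the algorithm is run. -/
structure Conventions : Prop where
  /-- the parallel step has positive probability -/
  αr_mem : A.αr ∈ Set.Ioc (0 : ℝ) 1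
  α_mem : A.α ∈ Set.Ioo (0 : ℝ) 1
  /-- a pair of neighbours is chosen among the remaining levels -/
  w_nonneg : ∀ N i, 0 ≤ A.w N i
  w_eq_zero : ∀ (N : ℕ) (i : Fin L), N ≤ i.val + 1 → A.w N i = 0
  w_sum : ∀ N : ℕ, 2 ≤ N → N ≤ L → ∑ i : Fin L, A.w N i = 1
  /-- the learning coefficients are nonnegative and vanish in the limit -/
  b_nonneg : ∀ n, 0 ≤ A.b n
  b_tendsto : Tendsto A.b atTop (𝓝 0)
  /-- the inverse temperatures are positive and bounded -/
  T_pos : ∀ t ∈ A.T, 0 < t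
  T_bdd : BddAbove A.T
  /-- the reference function is continuous and positive on the support of the target -/
  ref_cont : ContinuousOn A.ref A.S
  ref_pos : ∀ x ∈ A.S, 0 < A.ref x
  /-- each proposal is a probability density on the whole space -/
  q_meas : ∀ γ ∈ A.varBox, ∀ x ∈ A.S, Measurable (A.q γ x)
  q_nonneg : ∀ γ ∈ A.varBox, ∀ x ∈ A.S, ∀ y, 0 ≤ A.q γ x y
  q_lintegral : ∀ γ ∈ A.varBox, ∀ x ∈ A.S, ∫⁻ y, ENNReal.ofReal (A.q γ x y) = 1
  /-- Metropolis proposals are symmetric -/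
  q_symm : ∀ γ ∈ A.varBox, ∀ x ∈ A.S, ∀ y ∈ A.S, A.q γ x y = A.q γ y x

end Spec

/-- The random quantities of the algorithm at the times `0, 1, 2, …`. -/
structure Run (p L : ℕ) (Ω : Type*) where
  /-- positions of the levels -/
  X : ℕ → Ω → Fin L → E p
  /-- outcome of the iteration that leads from time `n` to time `n + 1` -/
  move : ℕ → Ω → Move L
  /-- log inverse temperatures -/
  ζ : ℕ → Ω → Fin L → ℝ
  /-- proposal variances -/
  γ : ℕ → Ω → Fin L → Fin p → ℝ
  /-- auxiliary means -/
  μ : ℕ → Ω → Fin L → Fin p → ℝ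
  /-- counters of the positive flatness checks -/
  cnt : ℕ → Ω → Fin L → ℕ
  /-- number of levels that are left -/
  N : ℕ → Ω → ℕ
  /-- (random) learning coefficients of the inverse temperatures -/
  a : ℕ → Ω → Fin L → ℝ

/-- Update of a parameter within a prescribed range `B`: the parameter stays in `B`, the proposed
value `prop` is taken whenever it lies in `B`, and otherwise the parameter is moved by no more than
was proposed (for instance, projected to an interval `B`, or left unchanged). -/
def RangeUpdate (B : Set ℝ) (old prop new : ℝ) : Prop :=
  new ∈ B ∧ (prop ∈ B → new = prop) ∧ |new - old| ≤ |prop - old|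

open Classical in
/-- New number of levels: the first of the `N` remaining levels whose counter has reached `d`
becomes the last level; if there is none, nothing changes. -/
def newCount {L : ℕ} (d N : ℕ) (cnt : Fin L → ℕ) : ℕ :=
  if ∃ l : Fin L, l.val < N ∧ d ≤ cnt l then
    sInf {k : ℕ | ∃ l : Fin L, l.val < N ∧ d ≤ cnt l ∧ k = l.val + 1}
  else N

namespace Run

variable {p L : ℕ} {Ω : Type*} (R : Run p L Ω)

/-- Inverse temperatures. -/
def temp (n : ℕ) (ω : Ω) (l : Fin L) : ℝ := Real.exp (R.ζ n ω l)

/-- Sample mean of a coordinate of a level over the times `0, …, n`. -/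
def sampleMean (n : ℕ) (ω : Ω) (l : Fin L) (j : Fin p) : ℝ :=
  (∑ k ∈ Finset.range (n + 1), R.X k ω l j) / (n + 1)

/-- Sample variance of a coordinate of a level over the times `0, …, n`. -/
def sampleVar (n : ℕ) (ω : Ω) (l : Fin L) (j : Fin p) : ℝ :=
  (∑ k ∈ Finset.range (n + 1), (R.X k ω l j - R.sampleMean n ω l j) ^ 2) / (n + 1)

/-- Flatness criterion for a level. -/
def Flat (n : ℕ) (ω : Ω) (l : Fin L) : Prop :=
  ∏ j, R.sampleVar n ω l j ≤ ∏ j, R.γ n ω l j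

/-- `R` is a realisation of the adaptive parallel tempering algorithm with data `A` on the
probability space `(Ω, P)`, with history `ℱ`, started from the position `x₀`, the log inverse
temperatures `ζ₀`, the proposal variances `γ₀` and the auxiliary means `μ₀`. -/
structure IsAdaptivePT [MeasurableSpace Ω] (A : Spec p L) (P : Measure Ω)
    (ℱ : Filtration ℕ (inferInstance : MeasurableSpace Ω))
    (x₀ : Fin L → E p) (ζ₀ : Fin L → ℝ) (γ₀ μ₀ : Fin L → Fin p → ℝ) : Prop where
  -- everything is known from the history
  X_meas : ∀ n, Measurable[ℱ n] (R.X n)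
  move_meas : ∀ n, Measurable[ℱ (n + 1)] (R.move n)
  ζ_meas : ∀ n, Measurable[ℱ n] (R.ζ n)
  γ_meas : ∀ n, Measurable[ℱ n] (R.γ n)
  μ_meas : ∀ n, Measurable[ℱ n] (R.μ n)
  cnt_meas : ∀ n, Measurable[ℱ n] (R.cnt n)
  N_meas : ∀ n, Measurable[ℱ n] (R.N n)
  a_meas : ∀ n, Measurable (R.a n)
  -- initial values
  init : ∀ᵐ ω ∂P, R.X 0 ω = x₀ ∧ R.ζ 0 ω = ζ₀ ∧ R.γ 0 ω = γ₀ ∧ R.μ 0 ω = μ₀ ∧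
    (∀ l, R.cnt 0 ω l = 0) ∧ R.N 0 ω = L
  -- sampling: conditional law of the iteration given the past
  step : ∀ (n : ℕ) (B : Set (Move L × (Fin L → E p))), MeasurableSet B →
    P⟦(fun ω => (R.move n ω, R.X (n + 1) ω)) ⁻¹' B | ℱ n⟧ =ᵐ[P]
      fun ω => (A.stepLaw (R.N n ω) (R.γ n ω) (R.temp n ω) (R.X n ω)).real B
  -- inverse temperature learning, after an exchange step
  ζ_exchange : ∀ n, ∀ᵐ ω ∂P, ∀ i acc, R.move n ω = Move.exchange i acc →
    RangeUpdate {z | Real.exp z ∈ A.T} (R.ζ n ω (next i))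
      (R.ζ n ω (next i) - R.a n ω (next i) * ((if acc = true then 1 else 0) - A.α))
      (R.ζ (n + 1) ω (next i)) ∧
    ∀ l, l ≠ next i → R.ζ (n + 1) ω l = R.ζ n ω l
  ζ_other : ∀ n, ∀ᵐ ω ∂P, (∀ i acc, R.move n ω ≠ Move.exchange i acc) →
    R.ζ (n + 1) ω = R.ζ n ω
  a_tendsto : ∀ᵐ ω ∂P, ∀ l, Tendsto (fun n => R.a n ω l) atTop (𝓝 0)
  -- proposal parameter learning, after a parallel step
  μ_parallel : ∀ n, ∀ᵐ ω ∂P, R.move n ω = Move.parallel → ∀ l : Fin L, l.val < R.N n ω → ∀ j,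
    R.μ (n + 1) ω l j = R.μ n ω l j + A.b n * (R.X (n + 1) ω l j - R.μ n ω l j)
  γ_parallel : ∀ n, ∀ᵐ ω ∂P, R.move n ω = Move.parallel → ∀ l : Fin L, l.val < R.N n ω → ∀ j,
    RangeUpdate (Set.Icc A.c A.C) (R.γ n ω l j)
      (R.γ n ω l j + A.b n * ((R.X (n + 1) ω l j - R.μ (n + 1) ω l j) ^ 2 - R.γ n ω l j))
      (R.γ (n + 1) ω l j)
  -- an accepted exchange resets the two auxiliary means
  μ_exchange : ∀ n, ∀ᵐ ω ∂P, ∀ i, R.move n ω = Move.exchange i true →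
    ∀ l, l = i ∨ l = next i → ∀ j, R.μ (n + 1) ω l j = R.X (n + 1) ω l j
  -- otherwise the proposal parameters are kept
  μ_other : ∀ n, ∀ᵐ ω ∂P, ∀ l : Fin L, ¬ (R.move n ω = Move.parallel ∧ l.val < R.N n ω) →
    (∀ i, R.move n ω = Move.exchange i true → l ≠ i ∧ l ≠ next i) →
    R.μ (n + 1) ω l = R.μ n ω l
  γ_other : ∀ n, ∀ᵐ ω ∂P, ∀ l : Fin L, ¬ (R.move n ω = Move.parallel ∧ l.val < R.N n ω) →
    R.γ (n + 1) ω l = R.γ n ω l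
  -- minimum inverse temperature decision, at the times `m, 2 m, …`; a failed check leaves the
  -- counter (cumulative count) or resets it (count of checks in succession)
  cnt_flat : ∀ n, 0 < n → A.m ∣ n → ∀ᵐ ω ∂P, ∀ l : Fin L, l.val < R.N n ω → R.Flat n ω l →
    R.cnt (n + 1) ω l = R.cnt n ω l + 1
  cnt_not_flat : ∀ n, 0 < n → A.m ∣ n → ∀ᵐ ω ∂P, ∀ l : Fin L, l.val < R.N n ω → ¬ R.Flat n ω l →
    R.cnt (n + 1) ω l = R.cnt n ω l ∨ R.cnt (n + 1) ω l = 0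
  cnt_other : ∀ n, ∀ᵐ ω ∂P, ∀ l : Fin L, ¬ (0 < n ∧ A.m ∣ n ∧ l.val < R.N n ω) →
    R.cnt (n + 1) ω l = R.cnt n ω l
  N_check : ∀ n, 0 < n → A.m ∣ n → ∀ᵐ ω ∂P,
    R.N (n + 1) ω = newCount A.d (R.N n ω) (R.cnt (n + 1) ω)
  N_other : ∀ n, ¬ (0 < n ∧ A.m ∣ n) → ∀ᵐ ω ∂P, R.N (n + 1) ω = R.N n ω

end Run

/-- Total variation distance of two probability measures, `sup_B |μ B - ν B|`. -/
def tvDist {X : Type*} [MeasurableSpace X] (μ ν : Measure X) : ℝ :=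
  ⨆ B : {B : Set X // MeasurableSet B}, |μ.real B.1 - ν.real B.1|

end AdaptivePT

end

/-! The law of the positions is compared, over a window of fixed length `K`, with a Markov chain
whose parameters are frozen at the start of the window. Two facts make this work.

Uniform contraction: `S` and `Γ^p` are compact and the inverse temperatures are bounded, so the
density of an accepted Metropolis move has a positive lower bound on `S × S` for all parameters. A
parallel step then moves all remaining levels at once with a common minorization, of mass `β`
independent of the parameters (`exists_minorization`).

Diminishing adaptation: positions stay in a compact set, so the auxiliary means are bounded along
each path, and since `b_n` and `a_n` tend to zero the increments of the parameters vanish almost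
surely (`ae_tendsto_par`). The number of levels is a nonincreasing sequence of natural numbers,
hence eventually constant.

On `S` the tempered density is proportional to `r exp (t log (π / r))`. The normalising constants
cancel in all acceptance ratios, which are therefore continuous in positions and parameters up to `t
= 0`. Uniform continuity on a compact set makes the kernels uniformly continuous in the parameters
in total variation (`exists_uniform_chainKernel`). By detailed balance, each frozen kernel preserves
the product of the tempered laws of the remaining levels (`chainTarget_bind`), whose marginal at
level `0` is `π`. Removed levels sit at arbitrary points and would spoil the minorization; `freeze`
puts them at a fixed point, which commutes with the kernel.

No coupling is built. On an event of the past, each step multiplies the discrepancy to the invariant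
law by `1 - β` and adds the error of the frozen kernel (`abs_real_inter_sub_le`). The past at time
`n` is cut into finitely many cells, according to the number of levels and a net of parameters, and
in each cell the kernel of the net point serves as the frozen one. The event that the parameters
drift during the window depends on the future of `n`, so it enters as an additive error only. All
errors are additive over the cells, so the size of the net does not matter. -/

namespace AdaptivePT

/-! ### Products of measures and of kernels -/

section ProductMeasures

open scoped ENNReal

variable {ι X : Type*} [Fintype ι] [MeasurableSpace X]

theorem lintegral_fin_prod_eq_prod {n : ℕ} {μ : Fin n → Measure X} [∀ i, SigmaFinite (μ i)]
    {f : Fin n → X → ℝ≥0∞} (hf : ∀ i, Measurable (f i)) :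
    ∫⁻ x, ∏ i, f i (x i) ∂Measure.pi μ = ∏ i, ∫⁻ x, f i x ∂μ i := by
  induction n with
  | zero => simp
  | succ n ih =>
    have hm : Measurable fun x : Fin n → X => ∏ i, f i.succ (x i) := by
      exact Finset.measurable_fun_prod _ fun i _ => (hf _).comp (measurable_pi_apply i)
    calc
      _ = ∫⁻ x : X × (Fin n → X), f 0 x.1 * ∏ i : Fin n, f i.succ (x.2 i)
            ∂((μ 0).prod (Measure.pi fun i => μ i.succ)) := by
          rw [← ((measurePreserving_piFinSuccAbove μ 0).symm).lintegral_comp_emb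
            (MeasurableEquiv.measurableEmbedding _)]
          refine lintegral_congr fun x => ?_
          simp [MeasurableEquiv.piFinSuccAbove_symm_apply, Fin.insertNthEquiv,
            Fin.prod_univ_succ]
      _ = (∫⁻ x, f 0 x ∂μ 0) * ∏ i : Fin n, ∫⁻ x, f i.succ x ∂μ i.succ := by
          rw [← ih fun i => hf _, ← lintegral_prod_mul (hf 0).aemeasurable hm.aemeasurable]
      _ = _ := by rw [Fin.prod_univ_succ]

/-- Tonelli's theorem for a product of functions of one coordinate each. -/
theorem lintegral_fintype_prod_eq_prod {μ : ι → Measure X} [∀ i, SigmaFinite (μ i)]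
    {f : ι → X → ℝ≥0∞} (hf : ∀ i, Measurable (f i)) :
    ∫⁻ x, ∏ i, f i (x i) ∂Measure.pi μ = ∏ i, ∫⁻ x, f i x ∂μ i := by
  let e := (Fintype.equivFin ι).symm
  rw [← (measurePreserving_piCongrLeft (fun i => μ i) e).lintegral_comp_emb
    (MeasurableEquiv.measurableEmbedding _)]
  simp_rw [← e.prod_comp, MeasurableEquiv.coe_piCongrLeft, Equiv.piCongrLeft_apply_apply]
  exact lintegral_fin_prod_eq_prod fun i => hf _

/-- The comparison is made for the outer measures on boxes, so no σ-finiteness is needed. -/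
theorem measurePi_mono {μ ν : ι → Measure X} (h : ∀ i, μ i ≤ ν i) :
    Measure.pi μ ≤ Measure.pi ν := by
  refine Measure.le_iff.2 fun s hs => ?_
  rw [Measure.pi, Measure.pi, toMeasure_apply _ _ hs, toMeasure_apply _ _ hs]
  suffices OuterMeasure.pi (fun i => (μ i).toOuterMeasure) ≤
      OuterMeasure.pi fun i => (ν i).toOuterMeasure from this s
  rw [OuterMeasure.le_pi]
  intro s _
  exact (OuterMeasure.pi_pi_le _ s).trans (Finset.prod_le_prod' fun i _ => h i _)

theorem measurable_measurePi {κ : ι → X → Measure X} [∀ i x, IsProbabilityMeasure (κ i x)]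
    (hκ : ∀ i, Measurable (κ i)) :
    Measurable fun x : ι → X => Measure.pi fun i => κ i (x i) := by
  refine Measurable.measure_of_isPiSystem_of_isProbabilityMeasure generateFrom_pi.symm
    isPiSystem_pi ?_
  rintro _ ⟨s, hs, rfl⟩
  simp only [Measure.pi_pi]
  exact Finset.measurable_fun_prod _ fun i _ =>
    ((Measure.measurable_coe (hs i (Set.mem_univ i))).comp (hκ i)).comp (measurable_pi_apply i)

/-- A product of kernels maps a product of invariant measures to itself. -/
theorem measurePi_bind {κ : ι → X → Measure X} [∀ i x, IsProbabilityMeasure (κ i x)]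
    (hκ : ∀ i, Measurable (κ i)) {μ : ι → Measure X} [∀ i, SigmaFinite (μ i)]
    (h : ∀ i, (μ i).bind (κ i) = μ i) :
    (Measure.pi μ).bind (fun x => Measure.pi fun i => κ i (x i)) = Measure.pi μ := by
  refine (Measure.pi_eq fun s hs => ?_).symm
  rw [Measure.bind_apply (.univ_pi hs) (measurable_measurePi hκ).aemeasurable]
  simp only [Measure.pi_pi]
  rw [lintegral_fintype_prod_eq_prod (f := fun i x => κ i x (s i))
    fun i => (Measure.measurable_coe (hs i)).comp (hκ i)]
  refine Finset.prod_congr rfl fun i _ => ?_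
  rw [← Measure.bind_apply (hs i) (hκ i).aemeasurable, h]

theorem measurePi_withDensity {μ : ι → Measure X} [∀ i, SigmaFinite (μ i)]
    {f : ι → X → ℝ≥0∞} (hf : ∀ i, Measurable (f i))
    [∀ i, SigmaFinite ((μ i).withDensity (f i))] :
    Measure.pi (fun i => (μ i).withDensity (f i)) =
      (Measure.pi μ).withDensity fun x => ∏ i, f i (x i) := by
  refine Measure.pi_eq fun s hs => ?_
  rw [withDensity_apply _ (.univ_pi hs), ← lintegral_indicator (.univ_pi hs)]
  have : (Set.univ.pi s).indicator (fun x => ∏ i, f i (x i)) =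
      fun x => ∏ i, (s i).indicator (f i) (x i) := by
    ext x
    by_cases hx : x ∈ Set.univ.pi s
    · rw [Set.indicator_of_mem hx]
      exact Finset.prod_congr rfl fun i _ => (Set.indicator_of_mem (hx i trivial) _).symm
    · rw [Set.indicator_of_notMem hx]
      simp only [Set.mem_pi, Set.mem_univ, true_imp_iff, not_forall] at hx
      obtain ⟨i, hi⟩ := hx
      exact (Finset.prod_eq_zero (Finset.mem_univ i) (Set.indicator_of_notMem hi _)).symm
  rw [this, lintegral_fintype_prod_eq_prod fun i => (hf i).indicator (hs i)]
  refine Finset.prod_congr rfl fun i _ => ?_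
  rw [lintegral_indicator (hs i), withDensity_apply _ (hs i)]

theorem measurePi_map_comp_perm {μ : ι → Measure X} [∀ i, SigmaFinite (μ i)]
    (σ : Equiv.Perm ι) (h : ∀ i, μ (σ i) = μ i) :
    (Measure.pi μ).map (fun x => x ∘ σ) = Measure.pi μ := by
  have hσ : Measurable fun x : ι → X => x ∘ σ :=
    measurable_pi_lambda _ fun i => measurable_pi_apply _
  refine (Measure.pi_eq fun s hs => ?_).symm
  rw [Measure.map_apply hσ (.univ_pi hs)]
  have : (fun x : ι → X => x ∘ σ) ⁻¹' Set.univ.pi s = Set.univ.pi fun i => s (σ.symm i) := by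
    ext x
    simp only [Set.mem_preimage, Set.mem_pi, Set.mem_univ, true_imp_iff, Function.comp]
    exact ⟨fun hx i => by simpa using hx (σ.symm i), fun hx i => by simpa using hx (σ i)⟩
  rw [this, Measure.pi_pi, ← Equiv.prod_comp σ]
  simp [h]

/-- Two products of probability measures are close on every set if the factors have a common
part of mass almost one. -/
theorem measurePi_real_le_of_common {μ ν η : ι → Measure X}
    [∀ i, IsProbabilityMeasure (μ i)] [∀ i, IsProbabilityMeasure (ν i)]
    (hμ : ∀ i, η i ≤ μ i) (hν : ∀ i, η i ≤ ν i) {δ : ℝ} (hδ1 : δ ≤ 1)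
    (hη : ∀ i, 1 - δ ≤ (η i).real Set.univ) {B : Set (ι → X)} (hB : MeasurableSet B) :
    (Measure.pi μ).real B ≤ (Measure.pi ν).real B + Fintype.card ι * δ := by
  have : ∀ i, IsFiniteMeasure (η i) := fun i => isFiniteMeasure_of_le _ (hμ i)
  have h1 : 1 - Fintype.card ι * δ ≤ (Measure.pi η).real Set.univ := by
    have h2 : (Measure.pi η).real Set.univ = ∏ i, (η i).real Set.univ := by
      simp [Measure.real, Measure.pi_univ, ENNReal.toReal_prod]
    rw [h2]
    -- Bernoulli's inequality; `δ ≤ 1` keeps the factors `1 - δ` nonnegative.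
    calc 1 - Fintype.card ι * δ = 1 + Fintype.card ι * (-δ) := by ring
      _ ≤ (1 + -δ) ^ Fintype.card ι := one_add_mul_le_pow (by linarith) _
      _ = ∏ _i : ι, (1 - δ) := by simp [sub_eq_add_neg]
      _ ≤ _ := Finset.prod_le_prod (fun i _ => by linarith) fun i _ => hη i
  have h2 : (Measure.pi η).real B ≤ (Measure.pi ν).real B :=
    ENNReal.toReal_mono (measure_ne_top _ _) (measurePi_mono hν B)
  -- For the products, `μ B = 1 - μ Bᶜ ≤ 1 - η Bᶜ = 1 - η univ + η B`, and `η B ≤ ν B`.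
  have h3 : (Measure.pi η).real Bᶜ ≤ (Measure.pi μ).real Bᶜ :=
    ENNReal.toReal_mono (measure_ne_top _ _) (measurePi_mono hμ Bᶜ)
  have h4 := measureReal_add_measureReal_compl (μ := Measure.pi η) hB
  have h5 := measureReal_add_measureReal_compl (μ := Measure.pi μ) hB
  have h6 : (Measure.pi μ).real Set.univ = 1 := probReal_univ
  linarith

end ProductMeasures

/-- If two finite measures differ by at most `D` on all measurable sets, then their integrals
of a function with values in `[0, M]` differ by at most `M * D`. -/
theorem abs_integral_sub_integral_le {Y : Type*} [MeasurableSpace Y] {μ ν : Measure Y}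
    [IsFiniteMeasure μ] [IsFiniteMeasure ν] {D M : ℝ} (hM : 0 ≤ M)
    (hD : ∀ B, MeasurableSet B → |μ.real B - ν.real B| ≤ D) {h : Y → ℝ} (hh : Measurable h)
    (h0μ : ∀ᵐ x ∂μ, 0 ≤ h x) (h0ν : ∀ᵐ x ∂ν, 0 ≤ h x)
    (h1μ : ∀ᵐ x ∂μ, h x ≤ M) (h1ν : ∀ᵐ x ∂ν, h x ≤ M) :
    |∫ x, h x ∂μ - ∫ x, h x ∂ν| ≤ M * D := by
  have hint : ∀ {ρ : Measure Y} [IsFiniteMeasure ρ], (∀ᵐ x ∂ρ, 0 ≤ h x) → (∀ᵐ x ∂ρ, h x ≤ M) →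
      Integrable h ρ := fun {ρ} _ h0 h1 => by
    refine Integrable.of_bound hh.aestronglyMeasurable M ?_
    filter_upwards [h0, h1] with x h0 h1
    rw [Real.norm_of_nonneg h0]; exact h1
  have hI : ∀ ρ : Measure Y, [IsFiniteMeasure ρ] →
      IntegrableOn (fun t => ρ.real {a | t ≤ h a}) (Set.Ioc 0 M) := fun ρ _ => by
    have hanti : Antitone fun t => ρ.real {a | t ≤ h a} := fun s t hst =>
      measureReal_mono fun a ha => le_trans hst ha
    refine Measure.integrableOn_of_bounded (M := ρ.real Set.univ) (by simp)
      hanti.measurable.aestronglyMeasurable (ae_of_all _ fun t => ?_)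
    rw [Real.norm_of_nonneg measureReal_nonneg]
    exact measureReal_mono (Set.subset_univ _)
  -- Layer cake: both integrals are integrals over `(0, M]` of the masses of superlevel sets, which
  -- differ by at most `D`.
  rw [(hint h0μ h1μ).integral_eq_integral_Ioc_meas_le h0μ h1μ,
    (hint h0ν h1ν).integral_eq_integral_Ioc_meas_le h0ν h1ν, ← integral_sub (hI μ) (hI ν),
    ← Real.norm_eq_abs]
  refine (norm_setIntegral_le_of_norm_le_const (C := D) (by simp) fun t _ => ?_).trans ?_
  · exact hD _ (measurableSet_le measurable_const hh)
  · simp [hM, mul_comm]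

/-! ### Metropolis kernels given by a density of accepted moves -/

section MetropolisKernel

open scoped ENNReal

variable {X : Type*} [MeasurableSpace X]

/-- The Metropolis-type kernel that moves with density `k x` with respect to `lam` and otherwise
stays where it is. -/
noncomputable def densityKernel (lam : Measure X) (k : X → X → ℝ≥0∞) (x : X) : Measure X :=
  lam.withDensity (k x) + (1 - ∫⁻ y, k x y ∂lam) • Measure.dirac x

variable {lam : Measure X} {k k' : X → X → ℝ≥0∞}

theorem isProbabilityMeasure_densityKernel (hk : ∀ x, ∫⁻ y, k x y ∂lam ≤ 1) (x : X) :
    IsProbabilityMeasure (densityKernel lam k x) :=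
  ⟨by simp [densityKernel, add_tsub_cancel_of_le (hk x)]⟩

theorem densityKernel_apply (x : X) {B : Set X} (hB : MeasurableSet B) :
    densityKernel lam k x B =
      ∫⁻ y, k x y * B.indicator 1 y ∂lam + (1 - ∫⁻ y, k x y ∂lam) * B.indicator 1 x := by
  simp only [densityKernel, Measure.add_apply, withDensity_apply _ hB, Measure.smul_apply,
    smul_eq_mul, Measure.dirac_apply' _ hB]
  rw [← lintegral_indicator hB]
  congr 2
  ext y
  by_cases hy : y ∈ B <;> simp [hy]

theorem measurable_densityKernel [SFinite lam] (hkm : Measurable (Function.uncurry k)) :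
    Measurable (densityKernel lam k) := by
  refine Measure.measurable_of_measurable_coe _ fun B hB => ?_
  simp only [densityKernel_apply _ hB]
  have h1 : Measurable (B.indicator (1 : X → ℝ≥0∞)) := measurable_one.indicator hB
  have h2 : Measurable fun x => ∫⁻ y, k x y ∂lam := hkm.lintegral_prod_right'
  refine Measurable.add ?_ ((measurable_const.sub h2).mul h1)
  exact Measurable.lintegral_prod_right' (f := fun z : X × X => k z.1 z.2 * B.indicator 1 z.2)
    (hkm.mul (h1.comp measurable_snd))

/-- Detailed balance implies invariance. -/
theorem withDensity_bind_densityKernel [SFinite lam] (hkm : Measurable (Function.uncurry k))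
    (hk : ∀ x, ∫⁻ y, k x y ∂lam ≤ 1) {f : X → ℝ≥0∞} (hf : Measurable f)
    (hrev : ∀ x y, f x * k x y = f y * k y x) :
    (lam.withDensity f).bind (densityKernel lam k) = lam.withDensity f := by
  refine Measure.ext fun B hB => ?_
  have h1 : Measurable (B.indicator (1 : X → ℝ≥0∞)) := measurable_one.indicator hB
  have h2 : Measurable fun x => ∫⁻ y, k x y ∂lam := hkm.lintegral_prod_right'
  have hkx : ∀ x, Measurable (k x) := fun x => hkm.comp measurable_prodMk_left
  have h3 : Measurable fun z : X × X => k z.1 z.2 * B.indicator 1 z.2 :=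
    hkm.mul (h1.comp measurable_snd)
  -- By Tonelli and detailed balance, the accepted flow that ends in `B` equals the accepted flow
  -- that starts in `B`; the holding part then completes it to the mass of `B`.
  have h4 : ∫⁻ x, f x * ∫⁻ y, k x y * B.indicator 1 y ∂lam ∂lam =
      ∫⁻ x, f x * ((∫⁻ y, k x y ∂lam) * B.indicator 1 x) ∂lam := by
    calc ∫⁻ x, f x * ∫⁻ y, k x y * B.indicator 1 y ∂lam ∂lam
        = ∫⁻ x, ∫⁻ y, f x * (k x y * B.indicator 1 y) ∂lam ∂lam := by
          refine lintegral_congr fun x => ?_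
          exact (lintegral_const_mul _ ((hkx x).mul h1)).symm
      _ = ∫⁻ y, ∫⁻ x, f x * (k x y * B.indicator 1 y) ∂lam ∂lam :=
          lintegral_lintegral_swap (((hf.comp measurable_fst).mul h3).aemeasurable)
      _ = ∫⁻ y, ∫⁻ x, (f y * B.indicator 1 y) * k y x ∂lam ∂lam := by
          refine lintegral_congr fun y => lintegral_congr fun x => ?_
          rw [← mul_assoc, hrev]; ring
      _ = _ := by
          refine lintegral_congr fun y => ?_
          rw [lintegral_const_mul _ (hkx y)]; ring
  rw [Measure.bind_apply hB (measurable_densityKernel hkm).aemeasurable]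
  simp only [densityKernel_apply _ hB]
  have h5 : Measurable fun x => ∫⁻ y, k x y * B.indicator 1 y ∂lam := h3.lintegral_prod_right'
  have h6 : Measurable fun x => ∫⁻ y, k x y * B.indicator 1 y ∂lam +
      (1 - ∫⁻ y, k x y ∂lam) * B.indicator 1 x := h5.add ((measurable_const.sub h2).mul h1)
  rw [lintegral_withDensity_eq_lintegral_mul _ hf h6]
  simp only [Pi.mul_apply, mul_add]
  have h7 : Measurable fun x => f x * ((∫⁻ y, k x y ∂lam) * B.indicator 1 x) :=
    hf.mul (h2.mul h1)
  have h8 : Measurable fun x => f x * ∫⁻ y, k x y * B.indicator 1 y ∂lam := hf.mul h5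
  rw [lintegral_add_left h8, h4, ← lintegral_add_left h7,
    withDensity_apply _ hB, ← lintegral_indicator hB]
  refine lintegral_congr fun x => ?_
  rw [← mul_add, ← add_mul, add_tsub_cancel_of_le (hk x)]
  by_cases hx : x ∈ B <;> simp [hx]

/-- The overlap is the minimum of the densities plus the smaller holding mass at `x`. The kernel
with the smaller holding mass exceeds this overlap only through its density, by at most `g`, so the
total loss is `δ` and not `2 * δ`. -/
theorem exists_common_densityKernel (hkm : ∀ x, Measurable (k x)) (hkm' : ∀ x, Measurable (k' x))
    (hk : ∀ x, ∫⁻ y, k x y ∂lam ≤ 1) (hk' : ∀ x, ∫⁻ y, k' x y ∂lam ≤ 1) {g : X → ℝ≥0∞} {δ : ℝ≥0∞}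
    (hg : ∫⁻ y, g y ∂lam ≤ δ) (x : X)
    (h : ∀ y, k x y ≤ k' x y + g y) (h' : ∀ y, k' x y ≤ k x y + g y) :
    ∃ η : Measure X, η ≤ densityKernel lam k x ∧ η ≤ densityKernel lam k' x ∧
      1 ≤ η Set.univ + δ := by
  set r := 1 - ∫⁻ y, k x y ∂lam with hr
  set r' := 1 - ∫⁻ y, k' x y ∂lam with hr'
  refine ⟨lam.withDensity (fun y => min (k x y) (k' x y)) + (min r r') • Measure.dirac x,
    ?_, ?_, ?_⟩
  · refine add_le_add (withDensity_mono (ae_of_all _ fun y => min_le_left _ _)) ?_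
    refine Measure.le_iff.2 fun s _ => ?_
    simp only [Measure.smul_apply, smul_eq_mul]
    gcongr; exact min_le_left _ _
  · refine add_le_add (withDensity_mono (ae_of_all _ fun y => min_le_right _ _)) ?_
    refine Measure.le_iff.2 fun s _ => ?_
    simp only [Measure.smul_apply, smul_eq_mul]
    gcongr; exact min_le_right _ _
  · have hmin : Measurable fun y => min (k x y) (k' x y) := (hkm x).min (hkm' x)
    have e : (lam.withDensity (fun y => min (k x y) (k' x y)) +
        (min r r') • Measure.dirac x) Set.univ = ∫⁻ y, min (k x y) (k' x y) ∂lam + min r r' := by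
      simp
    have b : ∀ (l : X → ℝ≥0∞), (∀ y, l y ≤ min (k x y) (k' x y) + g y) →
        ∫⁻ y, l y ∂lam ≤ ∫⁻ y, min (k x y) (k' x y) ∂lam + δ := fun l hl =>
      (lintegral_mono hl).trans (by rw [lintegral_add_left hmin]; gcongr)
    rw [e]
    rcases le_total r r' with hrr | hrr
    · rw [min_eq_left hrr, add_right_comm, ← add_tsub_cancel_of_le (hk x), ← hr]
      gcongr
      exact b _ fun y => by rw [min_add]; exact le_min le_self_add (h y)
    · rw [min_eq_right hrr, add_right_comm, ← add_tsub_cancel_of_le (hk' x), ← hr']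
      gcongr
      exact b _ fun y => by rw [min_add]; exact le_min (h' y) le_self_add

/-- The atom of rejected moves is discarded; this is the minorization of a single level. -/
theorem smul_restrict_le_densityKernel {c : ℝ≥0∞} {s : Set X} (hs : MeasurableSet s) {x : X}
    (h : ∀ y ∈ s, c ≤ k x y) : c • lam.restrict s ≤ densityKernel lam k x := by
  refine le_trans ?_ (Measure.le_add_right le_rfl)
  refine Measure.le_iff.2 fun B hB => ?_
  rw [withDensity_apply _ hB, Measure.smul_apply, smul_eq_mul, Measure.restrict_apply hB]
  calc c * lam (B ∩ s) = ∫⁻ _ in B ∩ s, c ∂lam := by simp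
    _ ≤ ∫⁻ y in B ∩ s, k x y ∂lam := setLIntegral_mono' (hB.inter hs) fun y hy => h y hy.2
    _ ≤ _ := lintegral_mono_set Set.inter_subset_left

end MetropolisKernel

/-! ### One step of parallel tempering as a kernel of the positions -/

section TemperingKernel

open scoped ENNReal

variable {X : Type*} [MeasurableSpace X] {L : ℕ}

/-- One step of parallel tempering for the positions alone: with probability `r` the levels move
independently by the kernels `κ`; otherwise a pair of neighbours is chosen with the weights `w` and
exchanged with probability `e`. -/
noncomputable def temperingKernel (r : ℝ) (w : Fin L → ℝ) (κ : Fin L → X → Measure X)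
    (e : Fin L → (Fin L → X) → ℝ) (x : Fin L → X) : Measure (Fin L → X) :=
  ENNReal.ofReal r • Measure.pi (fun l => κ l (x l)) +
    ENNReal.ofReal (1 - r) •
      ((∑ i, ENNReal.ofReal (w i) •
          (ENNReal.ofReal (e i x) • Measure.dirac (x ∘ Equiv.swap i (next i)) +
            ENNReal.ofReal (1 - e i x) • Measure.dirac x)) +
        ENNReal.ofReal (1 - ∑ i, w i) • Measure.dirac x)

variable {r : ℝ} {w : Fin L → ℝ} {κ : Fin L → X → Measure X} {e : Fin L → (Fin L → X) → ℝ}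

theorem temperingKernel_apply (x : Fin L → X) {B : Set (Fin L → X)} (hB : MeasurableSet B) :
    temperingKernel r w κ e x B = ENNReal.ofReal r * Measure.pi (fun l => κ l (x l)) B +
      ENNReal.ofReal (1 - r) * ((∑ i, ENNReal.ofReal (w i) *
          (ENNReal.ofReal (e i x) * B.indicator 1 (x ∘ Equiv.swap i (next i)) +
            ENNReal.ofReal (1 - e i x) * B.indicator 1 x)) +
        ENNReal.ofReal (1 - ∑ i, w i) * B.indicator 1 x) := by
  simp only [temperingKernel, Measure.add_apply, Measure.smul_apply, smul_eq_mul,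
    Measure.finsetSum_apply, Measure.dirac_apply' _ hB]

theorem measurable_comp_perm (σ : Equiv.Perm (Fin L)) : Measurable fun x : Fin L → X => x ∘ σ :=
  measurable_pi_lambda _ fun _ => measurable_pi_apply _

theorem isProbabilityMeasure_temperingKernel (hr : r ∈ Set.Icc (0 : ℝ) 1) (hw : ∀ i, 0 ≤ w i)
    (hw1 : ∑ i, w i ≤ 1) [∀ i x, IsProbabilityMeasure (κ i x)]
    (he : ∀ i x, e i x ∈ Set.Icc (0 : ℝ) 1) (x : Fin L → X) :
    IsProbabilityMeasure (temperingKernel r w κ e x) := by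
  refine ⟨?_⟩
  have h1 : ∀ i, ENNReal.ofReal (e i x) + ENNReal.ofReal (1 - e i x) = 1 := fun i => by
    rw [← ENNReal.ofReal_add (he i x).1 (by linarith [(he i x).2])]; simp
  rw [temperingKernel_apply _ .univ]
  simp only [measure_univ, Set.indicator_univ, Pi.one_apply, mul_one, h1]
  rw [← ENNReal.ofReal_sum_of_nonneg fun i _ => hw i,
    ← ENNReal.ofReal_add (Finset.sum_nonneg fun i _ => hw i) (by linarith)]
  simp only [add_sub_cancel, ENNReal.ofReal_one, mul_one]
  rw [← ENNReal.ofReal_add hr.1 (by linarith [hr.2])]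
  simp

theorem measurable_temperingKernel [∀ i x, IsProbabilityMeasure (κ i x)]
    (hκ : ∀ i, Measurable (κ i)) (he : ∀ i, Measurable (e i)) :
    Measurable (temperingKernel r w κ e) := by
  refine Measure.measurable_of_measurable_coe _ fun B hB => ?_
  simp only [temperingKernel_apply _ hB]
  have h1 : Measurable (B.indicator (1 : (Fin L → X) → ℝ≥0∞)) := measurable_one.indicator hB
  have h2 := (Measure.measurable_coe hB).comp (measurable_measurePi hκ)
  refine (h2.const_mul _).add (Measurable.const_mul (Measurable.add ?_ (h1.const_mul _)) _)
  refine Finset.measurable_fun_sum _ fun i _ => Measurable.const_mul (Measurable.add ?_ ?_) _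
  · exact (he i).ennreal_ofReal.mul (h1.comp (measurable_comp_perm _))
  · exact (measurable_const.sub (he i)).ennreal_ofReal.mul h1

/-- A product measure is invariant under parallel tempering if its factors are invariant under the
kernels of the levels, and the exchanges satisfy detailed balance. -/
theorem measurePi_bind_temperingKernel (hr : r ∈ Set.Icc (0 : ℝ) 1) (hw : ∀ i, 0 ≤ w i)
    (hw1 : ∑ i, w i ≤ 1) [∀ i x, IsProbabilityMeasure (κ i x)]
    (hκ : ∀ i, Measurable (κ i)) (he : ∀ i, Measurable (e i))
    (he1 : ∀ i x, e i x ∈ Set.Icc (0 : ℝ) 1) {μ : Fin L → Measure X}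
    [∀ i, IsProbabilityMeasure (μ i)] (hμ : ∀ i, (μ i).bind (κ i) = μ i)
    (hex : ∀ i, w i ≠ 0 → ∀ B, MeasurableSet B →
      ∫⁻ x, ENNReal.ofReal (e i x) * B.indicator 1 (x ∘ Equiv.swap i (next i)) ∂Measure.pi μ =
        ∫⁻ x, ENNReal.ofReal (e i x) * B.indicator 1 x ∂Measure.pi μ) :
    (Measure.pi μ).bind (temperingKernel r w κ e) = Measure.pi μ := by
  refine Measure.ext fun B hB => ?_
  rw [Measure.bind_apply hB (measurable_temperingKernel hκ he).aemeasurable]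
  simp only [temperingKernel_apply _ hB]
  have h1 : Measurable (B.indicator (1 : (Fin L → X) → ℝ≥0∞)) := measurable_one.indicator hB
  have h2 : Measurable fun x : Fin L → X => Measure.pi (fun l => κ l (x l)) B :=
    (Measure.measurable_coe hB).comp (measurable_measurePi hκ)
  have h3 : ∀ i, Measurable fun x : Fin L → X =>
      ENNReal.ofReal (e i x) * B.indicator 1 (x ∘ Equiv.swap i (next i)) := fun i =>
    (he i).ennreal_ofReal.mul (h1.comp (measurable_comp_perm _))
  have h4 : ∀ i, Measurable fun x : Fin L → X =>
      ENNReal.ofReal (1 - e i x) * B.indicator 1 x := fun i =>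
    (measurable_const.sub (he i)).ennreal_ofReal.mul h1
  have h4' : ∀ i, Measurable fun x : Fin L → X =>
      ENNReal.ofReal (e i x) * B.indicator 1 x := fun i => (he i).ennreal_ofReal.mul h1
  have hI : ∫⁻ x, B.indicator 1 x ∂Measure.pi μ = Measure.pi μ B := lintegral_indicator_one hB
  have h5 : ∫⁻ x, Measure.pi (fun l => κ l (x l)) B ∂Measure.pi μ = Measure.pi μ B := by
    rw [← Measure.bind_apply hB (measurable_measurePi hκ).aemeasurable, measurePi_bind hκ hμ]
  have h6 : ∀ i, ∫⁻ x, ENNReal.ofReal (w i) *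
      (ENNReal.ofReal (e i x) * B.indicator 1 (x ∘ Equiv.swap i (next i)) +
        ENNReal.ofReal (1 - e i x) * B.indicator 1 x) ∂Measure.pi μ =
      ENNReal.ofReal (w i) * Measure.pi μ B := fun i => by
    rw [lintegral_const_mul _ (by exact (h3 i).add (h4 i))]
    -- Pairs of weight zero are exempt from detailed balance; in the application these include the
    -- last level, which `next` pairs with itself.
    rcases eq_or_ne (w i) 0 with h0 | h0
    · simp [h0]
    rw [lintegral_add_left (h3 i), hex i h0 B hB, ← lintegral_add_left (h4' i), ← hI]
    congr 1
    refine lintegral_congr fun x => ?_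
    rw [← add_mul, ← ENNReal.ofReal_add (he1 i x).1 (by linarith [(he1 i x).2])]
    simp
  rw [lintegral_add_left (h2.const_mul _), lintegral_const_mul _ h2]
  rw [lintegral_const_mul _ (by
      refine Measurable.add ?_ (h1.const_mul _)
      exact Finset.measurable_fun_sum _ fun i _ => ((h3 i).add (h4 i)).const_mul _)]
  rw [lintegral_add_right _ (h1.const_mul _),
    lintegral_finsetSum _ (by exact fun i _ => ((h3 i).add (h4 i)).const_mul _),
    lintegral_const_mul _ h1, hI]
  simp only [h5, h6]
  rw [← Finset.sum_mul, ← add_mul, ← ENNReal.ofReal_sum_of_nonneg fun i _ => hw i,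
    ← ENNReal.ofReal_add (Finset.sum_nonneg fun i _ => hw i) (by linarith), ← mul_assoc,
    ← add_mul, add_sub_cancel, ENNReal.ofReal_one, mul_one,
    ← ENNReal.ofReal_add hr.1 (by linarith [hr.2])]
  simp

theorem temperingKernel_real (hr : r ∈ Set.Icc (0 : ℝ) 1) (hw : ∀ i, 0 ≤ w i)
    (hw1 : ∑ i, w i ≤ 1) [∀ i x, IsProbabilityMeasure (κ i x)]
    (he : ∀ i x, e i x ∈ Set.Icc (0 : ℝ) 1)
    (x : Fin L → X) {B : Set (Fin L → X)} (hB : MeasurableSet B) :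
    (temperingKernel r w κ e x).real B = r * (Measure.pi fun l => κ l (x l)).real B +
      (1 - r) * ((∑ i, w i * (e i x * B.indicator 1 (x ∘ Equiv.swap i (next i)) +
            (1 - e i x) * B.indicator 1 x)) + (1 - ∑ i, w i) * B.indicator 1 x) := by
  have hind : ∀ z : Fin L → X, B.indicator (1 : (Fin L → X) → ℝ≥0∞) z =
      ENNReal.ofReal (B.indicator 1 z) := fun z => by by_cases hz : z ∈ B <;> simp [hz]
  have hind0 : ∀ z : Fin L → X, 0 ≤ B.indicator (1 : (Fin L → X) → ℝ) z := fun z =>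
    Set.indicator_nonneg (fun _ _ => zero_le_one) _
  have he' : ∀ i, 0 ≤ 1 - e i x := fun i => by linarith [(he i x).2]
  have hr' : 0 ≤ 1 - r := by linarith [hr.2]
  have hp : ∀ i, 0 ≤ w i * (e i x * B.indicator 1 (x ∘ Equiv.swap i (next i)) +
      (1 - e i x) * B.indicator 1 x) := fun i =>
    mul_nonneg (hw i) (add_nonneg (mul_nonneg (he i x).1 (hind0 _)) (mul_nonneg (he' i) (hind0 _)))
  have hw1' : 0 ≤ 1 - ∑ i, w i := by linarith
  have key : ∀ i, ENNReal.ofReal (w i) *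
      (ENNReal.ofReal (e i x) * ENNReal.ofReal (B.indicator 1 (x ∘ Equiv.swap i (next i))) +
            ENNReal.ofReal (1 - e i x) * ENNReal.ofReal (B.indicator 1 x)) =
      ENNReal.ofReal (w i * (e i x * B.indicator 1 (x ∘ Equiv.swap i (next i)) +
            (1 - e i x) * B.indicator 1 x)) := fun i => by
    rw [ENNReal.ofReal_mul (hw i), ENNReal.ofReal_add (mul_nonneg (he i x).1 (hind0 _))
      (mul_nonneg (he' i) (hind0 _)), ENNReal.ofReal_mul (he i x).1, ENNReal.ofReal_mul (he' i)]
  rw [measureReal_def, temperingKernel_apply _ hB]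
  simp only [hind, key]
  rw [← ENNReal.ofReal_sum_of_nonneg fun i _ => hp i, ← ENNReal.ofReal_mul hw1',
    ← ENNReal.ofReal_add (Finset.sum_nonneg fun i _ => hp i) (mul_nonneg hw1' (hind0 _)),
    ← ENNReal.ofReal_mul hr', ← ofReal_measureReal, ← ENNReal.ofReal_mul hr.1,
    ← ENNReal.ofReal_add (mul_nonneg hr.1 measureReal_nonneg), ENNReal.toReal_ofReal]
  · exact add_nonneg (mul_nonneg hr.1 measureReal_nonneg) (mul_nonneg hr' (add_nonneg
      (Finset.sum_nonneg fun i _ => hp i) (mul_nonneg hw1' (hind0 _))))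
  · exact mul_nonneg hr' (add_nonneg
      (Finset.sum_nonneg fun i _ => hp i) (mul_nonneg hw1' (hind0 _)))

/-- Parallel tempering steps with close ingredients have close laws. -/
theorem temperingKernel_real_le (hr : r ∈ Set.Icc (0 : ℝ) 1) (hw : ∀ i, 0 ≤ w i)
    (hw1 : ∑ i, w i ≤ 1) {κ' : Fin L → X → Measure X} {e' : Fin L → (Fin L → X) → ℝ}
    [∀ i x, IsProbabilityMeasure (κ i x)] [∀ i x, IsProbabilityMeasure (κ' i x)]
    (he : ∀ i x, e i x ∈ Set.Icc (0 : ℝ) 1) (he' : ∀ i x, e' i x ∈ Set.Icc (0 : ℝ) 1)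
    (x : Fin L → X) {B : Set (Fin L → X)} (hB : MeasurableSet B) {a b : ℝ} (ha : 0 ≤ a)
    (hb : 0 ≤ b)
    (hpar : (Measure.pi fun l => κ l (x l)).real B ≤ (Measure.pi fun l => κ' l (x l)).real B + a)
    (hexc : ∀ i, |e i x - e' i x| ≤ b) :
    (temperingKernel r w κ e x).real B ≤ (temperingKernel r w κ' e' x).real B + (a + 2 * b) := by
  rw [temperingKernel_real hr hw hw1 he x hB, temperingKernel_real hr hw hw1 he' x hB]
  have hind0 : ∀ z : Fin L → X, 0 ≤ B.indicator (1 : (Fin L → X) → ℝ) z := fun z =>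
    Set.indicator_nonneg (fun _ _ => zero_le_one) _
  have hind1 : ∀ z : Fin L → X, B.indicator (1 : (Fin L → X) → ℝ) z ≤ 1 := fun z =>
    Set.indicator_le_self' (fun _ _ => zero_le_one) _
  have hs : ∑ i, w i * (e i x * B.indicator 1 (x ∘ Equiv.swap i (next i)) +
      (1 - e i x) * B.indicator 1 x) ≤
      (∑ i, w i * (e' i x * B.indicator 1 (x ∘ Equiv.swap i (next i)) +
      (1 - e' i x) * B.indicator 1 x)) + 2 * b := by
    calc _ ≤ ∑ i, (w i * (e' i x * B.indicator 1 (x ∘ Equiv.swap i (next i)) +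
            (1 - e' i x) * B.indicator 1 x) + w i * (2 * b)) := by
          refine Finset.sum_le_sum fun i _ => ?_
          rw [← mul_add]
          refine mul_le_mul_of_nonneg_left ?_ (hw i)
          -- The coefficients of acceptance and of rejection each change by at most `b`, and the
          -- indicators lie in `[0, 1]`.
          have h1 := abs_le.1 (hexc i)
          nlinarith [hind0 x, hind1 x, hind0 (x ∘ Equiv.swap i (next i)),
            hind1 (x ∘ Equiv.swap i (next i))]
      _ ≤ _ := by
          rw [Finset.sum_add_distrib, ← Finset.sum_mul]
          have : (∑ i, w i) * (2 * b) ≤ 1 * (2 * b) := by gcongr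
          linarith
  have h1 : r * (Measure.pi fun l => κ l (x l)).real B ≤
      r * (Measure.pi fun l => κ' l (x l)).real B + a := by
    have := mul_le_mul_of_nonneg_left hpar hr.1
    nlinarith [hr.2]
  have h2 := mul_le_mul_of_nonneg_left hs (by linarith [hr.2] : 0 ≤ 1 - r)
  nlinarith [hr.1]

/-- Only the parallel step is kept: an exchange permutes positions without creating new ones, so it
contributes nothing to a minorization. -/
theorem smul_measurePi_le_temperingKernel {m : Fin L → Measure X} {x : Fin L → X}
    (h : ∀ l, m l ≤ κ l (x l)) :
    ENNReal.ofReal r • Measure.pi m ≤ temperingKernel r w κ e x := by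
  refine le_trans ?_ (Measure.le_add_right le_rfl)
  refine Measure.le_iff.2 fun B _ => ?_
  simp only [Measure.smul_apply, smul_eq_mul]
  exact mul_le_mul_right (measurePi_mono h B) _

end TemperingKernel

/-! ### Detailed balance for exchanges -/

section Exchange

open scoped ENNReal

variable {ι X : Type*} [Fintype ι] [DecidableEq ι] [MeasurableSpace X]

/-- Detailed balance for the exchange of two levels `i`, `j` of a product measure. -/
theorem lintegral_swap_eq {base : ι → Measure X} [∀ l, SigmaFinite (base l)] {f : ι → X → ℝ≥0∞}
    (hf : ∀ l, Measurable (f l)) [∀ l, SigmaFinite ((base l).withDensity (f l))] {i j : ι}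
    (hij : i ≠ j) (hb : base i = base j) {e : (ι → X) → ℝ≥0∞} (he : Measurable e)
    (h : ∀ x, e (x ∘ Equiv.swap i j) * (f i (x j) * f j (x i)) = e x * (f i (x i) * f j (x j)))
    {B : Set (ι → X)} (hB : MeasurableSet B) :
    ∫⁻ x, e x * B.indicator 1 (x ∘ Equiv.swap i j)
        ∂Measure.pi (fun l => (base l).withDensity (f l)) =
      ∫⁻ x, e x * B.indicator 1 x ∂Measure.pi (fun l => (base l).withDensity (f l)) := by
  set σ := Equiv.swap i j with hσ
  have hσm : Measurable fun x : ι → X => x ∘ σ :=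
    measurable_pi_lambda _ fun _ => measurable_pi_apply _
  have h1 : Measurable (B.indicator (1 : (ι → X) → ℝ≥0∞)) := measurable_one.indicator hB
  have hF : Measurable fun x : ι → X => ∏ l, f l (x l) :=
    Finset.measurable_fun_prod _ fun l _ => (hf l).comp (measurable_pi_apply l)
  have hsplit : ∀ g : ι → ℝ≥0∞, ∏ l, g l = g i * g j * ∏ l ∈ (Finset.univ.erase i).erase j, g l :=
    fun g => by
      rw [← Finset.mul_prod_erase _ _ (Finset.mem_univ i), mul_assoc,
        Finset.mul_prod_erase _ _ (Finset.mem_erase.2 ⟨hij.symm, Finset.mem_univ j⟩)]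
  -- The swap affects only the factors `i` and `j` of the product density, and for these `h` is
  -- detailed balance.
  have hbal : ∀ x : ι → X, e (x ∘ σ) * ∏ l, f l ((x ∘ σ) l) = e x * ∏ l, f l (x l) := fun x => by
    rw [hsplit, hsplit (fun l => f l (x l)), ← mul_assoc, ← mul_assoc (e x)]
    congr 1
    · simpa [hσ] using h x
    · refine Finset.prod_congr rfl fun l hl => ?_
      simp only [Finset.mem_erase, Finset.mem_univ, and_true] at hl
      simp [hσ, Equiv.swap_apply_of_ne_of_ne hl.2 hl.1]
  have hmap : (Measure.pi base).map (fun x => x ∘ σ) = Measure.pi base := by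
    refine measurePi_map_comp_perm σ fun l => ?_
    rcases eq_or_ne l i with rfl | hli
    · simp [hσ, hb]
    rcases eq_or_ne l j with rfl | hlj
    · simp [hσ, hb]
    · simp [hσ, Equiv.swap_apply_of_ne_of_ne hli hlj]
  rw [measurePi_withDensity hf,
    lintegral_withDensity_eq_lintegral_mul _ hF (by exact he.mul (h1.comp hσm)),
    lintegral_withDensity_eq_lintegral_mul _ hF (by exact he.mul h1)]
  -- The swap preserves the base measure because the factors `i` and `j` agree. After this
  -- substitution the two integrands coincide pointwise by `hbal`.
  conv_rhs => rw [← hmap, lintegral_map (by exact hF.mul (he.mul h1)) hσm]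
  refine lintegral_congr fun x => ?_
  simp only [Pi.mul_apply]
  rw [← mul_assoc, ← mul_assoc, mul_comm _ (e x), mul_comm _ (e (x ∘ σ)), hbal]

end Exchange

/-! ### Contraction of a process that follows a kernel approximately -/

/-- A process whose transitions on the event `A` are close to those of a Markov kernel `K` with a
minorization is close to the invariant distribution of `K`. -/
theorem abs_real_inter_sub_le {Y Ω : Type*} [MeasurableSpace Y] [MeasurableSpace Ω]
    {P : Measure Ω} [IsProbabilityMeasure P] {X : ℕ → Ω → Y} (hX : ∀ n, Measurable (X n))
    {A : Set Ω} {K : Y → Measure Y} (hK : Measurable K)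
    [∀ x, IsProbabilityMeasure (K x)] {Q : Measure Y} [IsProbabilityMeasure Q]
    (hQ : Q.bind K = Q) {m : Measure Y} [IsFiniteMeasure m] {β : ℝ} (hβ0 : 0 ≤ β) (hβ1 : β ≤ 1)
    (hβ : β ≤ m.real Set.univ) {G : Set Y} (hG : ∀ x ∈ G, m ≤ K x)
    (hXG : ∀ n, ∀ᵐ ω ∂P, X n ω ∈ G) (hQG : ∀ᵐ x ∂Q, x ∈ G) {e : ℝ} {k : ℕ}
    (hstep : ∀ j < k, ∀ B, MeasurableSet B →
      |P.real (A ∩ X (j + 1) ⁻¹' B) - ∫ ω in A, (K (X j ω)).real B ∂P| ≤ e)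
    {B : Set Y} (hB : MeasurableSet B) :
    |P.real (A ∩ X k ⁻¹' B) - P.real A * Q.real B| ≤ (1 - β) ^ k * P.real A + k * e := by
  induction k generalizing B with
  | zero =>
    have h1 : P.real (A ∩ X 0 ⁻¹' B) ≤ P.real A := measureReal_mono Set.inter_subset_left
    have h2 : 0 ≤ P.real (A ∩ X 0 ⁻¹' B) := measureReal_nonneg
    have h3 : Q.real B ≤ 1 := measureReal_le_one
    have h4 : 0 ≤ Q.real B := measureReal_nonneg
    have h5 : 0 ≤ P.real A := measureReal_nonneg
    rw [abs_le]; constructor <;> simp <;> nlinarith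
  | succ k ih =>
    have hKB : Measurable fun x => (K x).real B :=
      ((Measure.measurable_coe hB).comp hK).ennreal_toReal
    -- This is the contraction: without its common part `m B`, the transition probability ranges in
    -- an interval of length `1 - β`. The upper bound is the minorization applied to `Bᶜ`.
    have hKm : ∀ x ∈ G, 0 ≤ (K x).real B - m.real B ∧ (K x).real B - m.real B ≤ 1 - β :=
      fun x hx => by
        have h1 : m.real B ≤ (K x).real B := ENNReal.toReal_mono (measure_ne_top _ _) (hG x hx B)
        have h2 : m.real Bᶜ ≤ (K x).real Bᶜ :=
          ENNReal.toReal_mono (measure_ne_top _ _) (hG x hx Bᶜ)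
        have h3 := measureReal_add_measureReal_compl (μ := m) hB
        have h4 := measureReal_add_measureReal_compl (μ := K x) hB
        have h5 : (K x).real Set.univ = 1 := probReal_univ
        constructor <;> linarith
    have hle0 : MeasurableSet {x | 0 ≤ (K x).real B - m.real B} :=
      measurableSet_le measurable_const (hKB.sub measurable_const)
    have hle1 : MeasurableSet {x | (K x).real B - m.real B ≤ 1 - β} :=
      measurableSet_le (hKB.sub measurable_const) measurable_const
    have hXA : ∀ᵐ ω ∂P.restrict A, X k ω ∈ G := ae_restrict_of_ae (hXG k)
    -- The law of `X k` on `A` is compared with `Q` scaled to the same mass, so that the constant `m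
    -- B` subtracted from the integrand cancels in the difference.
    set ν := (P.restrict A).map (X k) with hν
    set ν' := ENNReal.ofReal (P.real A) • Q with hν'
    have hfin : IsFiniteMeasure ν' := ⟨by simp [hν']⟩
    have hνr : ∀ C, MeasurableSet C → ν.real C = P.real (A ∩ X k ⁻¹' C) := fun C hC => by
      rw [hν, map_measureReal_apply (hX k) hC, measureReal_restrict_apply (hX k hC),
        Set.inter_comm]
    have hν'r : ∀ C, ν'.real C = P.real A * Q.real C := fun C => by
      simp [hν', measureReal_def, ENNReal.toReal_mul]
    have hcmp := abs_integral_sub_integral_le (μ := ν) (ν := ν') (M := 1 - β)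
      (D := (1 - β) ^ k * P.real A + k * e) (by linarith) (fun C hC => by
        rw [hνr C hC, hν'r]; exact ih (fun j hj => hstep j (by lia)) hC)
      (h := fun x => (K x).real B - m.real B) (hKB.sub measurable_const)
      ((ae_map_iff (hX k).aemeasurable hle0).2 (hXA.mono fun ω h => (hKm _ h).1))
      (Measure.ae_smul_measure (hQG.mono fun x h => (hKm x h).1) _)
      ((ae_map_iff (hX k).aemeasurable hle1).2 (hXA.mono fun ω h => (hKm _ h).2))
      (Measure.ae_smul_measure (hQG.mono fun x h => (hKm x h).2) _)
    have hint : ∀ (ρ : Measure Y) [IsFiniteMeasure ρ], Integrable (fun x => (K x).real B) ρ :=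
      fun ρ _ => Integrable.of_bound hKB.aestronglyMeasurable 1 (ae_of_all _ fun x => by
        rw [Real.norm_of_nonneg measureReal_nonneg]; exact measureReal_le_one)
    have hI1 : ∫ x, (K x).real B ∂ν = ∫ ω in A, (K (X k ω)).real B ∂P :=
      integral_map (hX k).aemeasurable hKB.aestronglyMeasurable
    have hI2 : ∫ x, (K x).real B ∂ν' = P.real A * Q.real B := by
      rw [hν', integral_smul_measure, ENNReal.toReal_ofReal measureReal_nonneg, smul_eq_mul]
      congr 1
      conv_rhs => rw [← hQ, measureReal_def, Measure.bind_apply hB hK.aemeasurable]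
      exact integral_toReal ((Measure.measurable_coe hB).comp hK).aemeasurable
        (ae_of_all _ fun x => measure_lt_top _ _)
    rw [integral_sub (hint ν) (integrable_const _), integral_sub (hint ν') (integrable_const _),
      hI1, hI2, integral_const, integral_const, hνr _ .univ, hν'r] at hcmp
    simp only [Set.preimage_univ, Set.inter_univ, probReal_univ, mul_one,
      sub_sub_sub_cancel_right] at hcmp
    have hs := hstep k (by lia) B hB
    have he : 0 ≤ e := (abs_nonneg _).trans hs
    have hke : (1 - β) * (k * e) ≤ k * e :=
      mul_le_of_le_one_left (by positivity) (by linarith)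
    calc |P.real (A ∩ X (k + 1) ⁻¹' B) - P.real A * Q.real B|
        ≤ |P.real (A ∩ X (k + 1) ⁻¹' B) - ∫ ω in A, (K (X k ω)).real B ∂P| +
          |∫ ω in A, (K (X k ω)).real B ∂P - P.real A * Q.real B| := abs_sub_le _ _ _
      _ ≤ e + (1 - β) * ((1 - β) ^ k * P.real A + k * e) := add_le_add hs hcmp
      _ ≤ (1 - β) ^ (k + 1) * P.real A + (k + 1) * e := by
          rw [mul_add, ← mul_assoc, ← pow_succ']; linarith
      _ = _ := by push_cast; rfl

/-! ### Tempered densities and acceptance probabilities on the support -/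

namespace Spec

variable {p L : ℕ}

/-- The assumptions on target and proposals under which the algorithm is ergodic. -/
structure Regular (A : Spec p L) : Prop extends A.Conventions where
  compact : IsCompact A.S
  dens_cont : ContinuousOn A.dens A.S
  dens_pos : ∀ x ∈ A.S, 0 < A.dens x
  dens_zero : ∀ x ∉ A.S, A.dens x = 0
  dens_int : ∫ x, A.dens x = 1
  q_cont : ContinuousOn (fun z : (E p × E p) × (Fin p → ℝ) => A.q z.2 z.1.1 z.1.2)
      ((A.S ×ˢ A.S) ×ˢ A.varBox)
  q_pos : ∀ γ ∈ A.varBox, ∀ x ∈ A.S, ∀ y ∈ A.S, 0 < A.q γ x y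

variable (A : Spec p L)

/-- The inverse temperatures that can occur. -/
def temps : Set ℝ := insert 1 A.T

/-- The pairs of proposal variances and inverse temperatures that can occur. -/
def params : Set ((Fin L → Fin p → ℝ) × (Fin L → ℝ)) :=
  {θ | ∀ l, θ.1 l ∈ A.varBox ∧ θ.2 l ∈ A.temps}

/-- Log ratio of the densities at the inverse temperatures `1` and `0`. -/
noncomputable def logRatio : E p → ℝ := A.S.indicator fun x => Real.log (A.dens x / A.ref x)

/-- The unnormalised tempered density on the support. -/
noncomputable def weight (t : ℝ) (x : E p) : ℝ := A.ref x * Real.exp (t * A.logRatio x)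

/-- The acceptance probability of a Metropolis move in terms of `weight`. -/
noncomputable def acceptOn (t : ℝ) (x y : E p) : ℝ :=
  min 1 (A.ref y / A.ref x * Real.exp (t * (A.logRatio y - A.logRatio x)))

/-- The acceptance probability of an exchange in terms of `logRatio`. -/
noncomputable def exchangeOn (t : Fin L → ℝ) (i : Fin L) (x : Fin L → E p) : ℝ :=
  min 1 (Real.exp ((t i - t (next i)) * (A.logRatio (x (next i)) - A.logRatio (x i))))

/-- Density of the accepted moves, cut off outside of the support. -/
noncomputable def moveDensity (γ : Fin p → ℝ) (t : ℝ) (x y : E p) : ENNReal :=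
  ENNReal.ofReal ((A.S ×ˢ A.S).indicator (fun z => A.q γ z.1 z.2 * A.acceptOn t z.1 z.2) (x, y))

/-- The kernel of a single level if `N` levels are left. -/
noncomputable def levelKernel (N : ℕ) (θ : (Fin L → Fin p → ℝ) × (Fin L → ℝ)) (l : Fin L) (x : E p) :
    Measure (E p) :=
  if l.val < N then densityKernel volume (A.moveDensity (θ.1 l) (θ.2 l)) x else Measure.dirac x

/-- The kernel of the positions if `N` levels are left and the parameters are `θ`. -/
noncomputable def chainKernel (N : ℕ) (θ : (Fin L → Fin p → ℝ) × (Fin L → ℝ)) :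
    (Fin L → E p) → Measure (Fin L → E p) :=
  temperingKernel A.αr (A.w N) (A.levelKernel N θ) (A.exchangeOn θ.2)

/-- The tempered distribution. -/
noncomputable def temperedMeasure (t : ℝ) : Measure (E p) :=
  volume.withDensity fun x => ENNReal.ofReal (A.tempered t x)

/-- The invariant distribution of the positions if `N` levels are left and the others are at `z`. -/
noncomputable def chainTarget (N : ℕ) (z : E p) (t : Fin L → ℝ) : Measure (Fin L → E p) :=
  Measure.pi fun l => if l.val < N then A.temperedMeasure (t l) else Measure.dirac z

variable {A}

theorem continuousOn_logRatio (hA : A.Regular) : ContinuousOn A.logRatio A.S := by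
  have h : ContinuousOn (fun x => Real.log (A.dens x / A.ref x)) A.S :=
    (hA.dens_cont.div hA.ref_cont fun x hx => (hA.ref_pos x hx).ne').log fun x hx =>
      (div_pos (hA.dens_pos x hx) (hA.ref_pos x hx)).ne'
  exact h.congr fun x hx => Set.indicator_of_mem hx _

theorem measurable_indicator_of_continuousOn {X : Type*} [TopologicalSpace X] [MeasurableSpace X]
    [OpensMeasurableSpace X] {f : X → ℝ} {s : Set X} (hs : MeasurableSet s)
    (hf : ContinuousOn f s) : Measurable (s.indicator f) := by
  classical
  rw [← Set.piecewise_eq_indicator]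
  exact hf.measurable_piecewise continuousOn_const hs

theorem measurableSet_support (hA : A.Regular) : MeasurableSet A.S := hA.compact.measurableSet

theorem measurable_logRatio (hA : A.Regular) : Measurable A.logRatio := by
  have := measurable_indicator_of_continuousOn (measurableSet_support hA) (continuousOn_logRatio hA)
  rwa [logRatio, Set.indicator_indicator, Set.inter_self] at this

theorem temps_pos (hA : A.Regular) {t : ℝ} (ht : t ∈ A.temps) : 0 < t := by
  rcases ht with rfl | ht
  · exact one_pos
  · exact hA.T_pos t ht

theorem exists_temps_subset (hA : A.Regular) : ∃ M, A.temps ⊆ Set.Icc 0 M := by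
  obtain ⟨M, hM⟩ := (hA.T_bdd.insert 1 : BddAbove A.temps)
  exact ⟨M, fun t ht => ⟨(temps_pos hA ht).le, hM ht⟩⟩

/-- Positivity on `S` allows logarithms, which turn the powers into one exponential, continuous in
`t` on the whole line and in `x` on `S`. -/
theorem dens_rpow_mul (hA : A.Regular) (t : ℝ) {x : E p} (hx : x ∈ A.S) :
    A.dens x ^ t * A.ref x ^ (1 - t) = A.weight t x := by
  have h1 := hA.dens_pos x hx
  have h2 := hA.ref_pos x hx
  rw [weight, logRatio, Set.indicator_of_mem hx, Real.rpow_def_of_pos h1, Real.rpow_def_of_pos h2,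
    Real.log_div h1.ne' h2.ne', ← Real.exp_add]
  nth_rewrite 2 [← Real.exp_log h2]
  rw [← Real.exp_add]
  congr 1; ring

theorem weight_pos (hA : A.Regular) (t : ℝ) {x : E p} (hx : x ∈ A.S) : 0 < A.weight t x :=
  mul_pos (hA.ref_pos x hx) (Real.exp_pos _)

theorem continuousOn_weight (hA : A.Regular) (t : ℝ) : ContinuousOn (A.weight t) A.S :=
  hA.ref_cont.mul (continuousOn_const.mul (continuousOn_logRatio hA)).rexp

/-- Otherwise the density would vanish almost everywhere and could not integrate to one. -/
theorem volume_support_pos (hA : A.Regular) : 0 < volume A.S := by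
  refine pos_iff_ne_zero.2 fun h => ?_
  have h1 : ∫ x, A.dens x = 0 := by
    refine integral_eq_zero_of_ae ?_
    filter_upwards [compl_mem_ae_iff.2 h] with x hx using hA.dens_zero x hx
  exact one_ne_zero (hA.dens_int.symm.trans h1)

/-- Outside of `S` the product vanishes because `0 ^ t = 0`, which requires `t ≠ 0`; nothing is
known about `ref` there. -/
theorem dens_rpow_mul_eq_indicator (hA : A.Regular) {t : ℝ} (ht : t ∈ A.temps) :
    (fun x => A.dens x ^ t * A.ref x ^ (1 - t)) = A.S.indicator (A.weight t) := by
  ext x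
  by_cases hx : x ∈ A.S
  · rw [Set.indicator_of_mem hx, dens_rpow_mul hA t hx]
  · rw [Set.indicator_of_notMem hx, hA.dens_zero x hx, Real.zero_rpow (temps_pos hA ht).ne',
      zero_mul]

theorem integral_weight_pos (hA : A.Regular) {t : ℝ} (ht : t ∈ A.temps) :
    0 < ∫ y, A.dens y ^ t * A.ref y ^ (1 - t) := by
  rw [dens_rpow_mul_eq_indicator hA ht, integral_indicator (measurableSet_support hA),
    setIntegral_pos_iff_support_of_nonneg_ae]
  · refine (volume_support_pos hA).trans_le (measure_mono fun x hx => ⟨?_, hx⟩)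
    exact (weight_pos hA t hx).ne'
  · exact (ae_restrict_iff' (measurableSet_support hA)).2
      (ae_of_all _ fun x hx => (weight_pos hA t hx).le)
  · exact (continuousOn_weight hA t).integrableOn_compact hA.compact

theorem tempered_eq (hA : A.Regular) (t : ℝ) {x : E p} (hx : x ∈ A.S) :
    A.tempered t x = A.weight t x / ∫ y, A.dens y ^ t * A.ref y ^ (1 - t) := by
  rw [tempered, dens_rpow_mul hA t hx]

theorem tempered_eq_zero (hA : A.Regular) {t : ℝ} (ht : t ∈ A.temps) {x : E p} (hx : x ∉ A.S) :
    A.tempered t x = 0 := by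
  rw [tempered, hA.dens_zero x hx, Real.zero_rpow (temps_pos hA ht).ne', zero_mul, zero_div]

theorem tempered_nonneg (hA : A.Regular) {t : ℝ} (ht : t ∈ A.temps) (x : E p) :
    0 ≤ A.tempered t x := by
  by_cases hx : x ∈ A.S
  · rw [tempered_eq hA t hx]
    exact div_nonneg (weight_pos hA t hx).le (integral_weight_pos hA ht).le
  · exact (tempered_eq_zero hA ht hx).ge

theorem measurable_tempered (hA : A.Regular) {t : ℝ} (ht : t ∈ A.temps) :
    Measurable (A.tempered t) := by
  unfold tempered
  refine Measurable.div_const ?_ _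
  rw [dens_rpow_mul_eq_indicator hA ht]
  exact measurable_indicator_of_continuousOn (measurableSet_support hA) (continuousOn_weight hA t)

theorem isProbabilityMeasure_temperedMeasure (hA : A.Regular) {t : ℝ} (ht : t ∈ A.temps) :
    IsProbabilityMeasure (A.temperedMeasure t) := by
  refine ⟨?_⟩
  have hint : Integrable (A.tempered t) := by
    refine Integrable.div_const ?_ _
    rw [dens_rpow_mul_eq_indicator hA ht, integrable_indicator_iff (measurableSet_support hA)]
    exact (continuousOn_weight hA t).integrableOn_compact hA.compact
  rw [temperedMeasure, withDensity_apply _ .univ, Measure.restrict_univ,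
    ← ofReal_integral_eq_lintegral_ofReal hint (ae_of_all _ (tempered_nonneg hA ht))]
  unfold tempered
  rw [integral_div, div_self (integral_weight_pos hA ht).ne', ENNReal.ofReal_one]

theorem ae_mem_support_temperedMeasure (hA : A.Regular) {t : ℝ} (ht : t ∈ A.temps) :
    ∀ᵐ x ∂A.temperedMeasure t, x ∈ A.S := by
  rw [temperedMeasure, ae_withDensity_iff (measurable_tempered hA ht).ennreal_ofReal]
  refine ae_of_all _ fun x hx => ?_
  by_contra h
  exact hx (by rw [tempered_eq_zero hA ht h, ENNReal.ofReal_zero])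

theorem temperedMeasure_one (hA : A.Regular) : A.temperedMeasure 1 = A.target := by
  unfold temperedMeasure target tempered
  simp [hA.dens_int]

/-- The normalising constants cancel, so continuity in `t` does not require a study of their
dependence on `t`. -/
theorem accept_eq (hA : A.Regular) {t : ℝ} (ht : t ∈ A.temps) {x y : E p} (hx : x ∈ A.S)
    (hy : y ∈ A.S) : A.accept t x y = A.acceptOn t x y := by
  have hZ := (integral_weight_pos hA ht).ne'
  have hr := (hA.ref_pos x hx).ne'
  rw [accept, acceptOn, tempered_eq hA t hx, tempered_eq hA t hy, div_div_div_cancel_right₀ hZ,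
    weight, weight, mul_sub, Real.exp_sub, mul_div_mul_comm]

/-- This is why the cut-off in `moveDensity` loses no accepted move from a point of `S`. -/
theorem accept_eq_zero (hA : A.Regular) {t : ℝ} (ht : t ∈ A.temps) {x y : E p} (hy : y ∉ A.S) :
    A.accept t x y = 0 := by
  rw [accept, tempered_eq_zero hA ht hy, zero_div]; simp

/-- Both normalising constants and both values of `ref` cancel in the exchange ratio. -/
theorem exchangeProb_eq (hA : A.Regular) {t : Fin L → ℝ} (ht : ∀ l, t l ∈ A.temps)
    {x : Fin L → E p} (hx : ∀ l, x l ∈ A.S) (i : Fin L) :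
    A.exchangeProb t x i = A.exchangeOn t i x := by
  have hZ := fun l => (integral_weight_pos hA (ht l)).ne'
  have hr := fun l => (hA.ref_pos _ (hx l)).ne'
  rw [exchangeProb, exchangeOn]
  congr 1
  simp only [tempered_eq hA _ (hx _), weight]
  have e : (t i - t (next i)) * (A.logRatio (x (next i)) - A.logRatio (x i)) =
      t i * A.logRatio (x (next i)) + t (next i) * A.logRatio (x i) -
        (t i * A.logRatio (x i) + t (next i) * A.logRatio (x (next i))) := by ring
  rw [e, Real.exp_sub, Real.exp_add, Real.exp_add]
  have h1 := hZ i
  have h2 := hZ (next i)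
  have h3 := hr i
  have h4 := hr (next i)
  generalize (∫ y, A.dens y ^ t i * A.ref y ^ (1 - t i)) = Z at h1 ⊢
  generalize (∫ y, A.dens y ^ t (next i) * A.ref y ^ (1 - t (next i))) = Z' at h2 ⊢
  field_simp

theorem acceptOn_nonneg (hA : A.Regular) (t : ℝ) {x y : E p} (hx : x ∈ A.S) (hy : y ∈ A.S) :
    0 ≤ A.acceptOn t x y :=
  le_min zero_le_one (mul_nonneg (div_pos (hA.ref_pos y hy) (hA.ref_pos x hx)).le
    (Real.exp_pos _).le)

theorem acceptOn_le_one (t : ℝ) (x y : E p) : A.acceptOn t x y ≤ 1 := min_le_left _ _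

theorem exchangeOn_mem (t : Fin L → ℝ) (i : Fin L) (x : Fin L → E p) :
    A.exchangeOn t i x ∈ Set.Icc (0 : ℝ) 1 :=
  ⟨le_min zero_le_one (Real.exp_pos _).le, min_le_left _ _⟩

theorem measurable_exchangeOn (hA : A.Regular) (t : Fin L → ℝ) (i : Fin L) :
    Measurable (A.exchangeOn t i) := by
  have h := measurable_logRatio hA
  unfold exchangeOn
  fun_prop

/-- The density of accepted moves is jointly continuous in positions and parameters. -/
theorem continuousOn_q_mul_acceptOn (hA : A.Regular) :
    ContinuousOn (fun z : (E p × E p) × ((Fin p → ℝ) × ℝ) =>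
      A.q z.2.1 z.1.1 z.1.2 * A.acceptOn z.2.2 z.1.1 z.1.2)
      ((A.S ×ˢ A.S) ×ˢ (A.varBox ×ˢ Set.univ)) := by
  have h1 : Set.MapsTo (fun z : (E p × E p) × ((Fin p → ℝ) × ℝ) => z.1.1)
      ((A.S ×ˢ A.S) ×ˢ (A.varBox ×ˢ Set.univ)) A.S := fun z hz => hz.1.1
  have h2 : Set.MapsTo (fun z : (E p × E p) × ((Fin p → ℝ) × ℝ) => z.1.2)
      ((A.S ×ˢ A.S) ×ˢ (A.varBox ×ˢ Set.univ)) A.S := fun z hz => hz.1.2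
  have c1 : Continuous fun z : (E p × E p) × ((Fin p → ℝ) × ℝ) => z.1.1 := by fun_prop
  have c2 : Continuous fun z : (E p × E p) × ((Fin p → ℝ) × ℝ) => z.1.2 := by fun_prop
  have c3 : Continuous fun z : (E p × E p) × ((Fin p → ℝ) × ℝ) => z.2.2 := by fun_prop
  refine ContinuousOn.mul ?_ ?_
  · exact hA.q_cont.comp (f := fun z : (E p × E p) × ((Fin p → ℝ) × ℝ) => (z.1, z.2.1))
      (by fun_prop) fun z hz => ⟨hz.1, hz.2.1⟩
  · unfold acceptOn
    refine ContinuousOn.inf continuousOn_const (ContinuousOn.mul (ContinuousOn.div ?_ ?_ ?_)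
      (c3.continuousOn.mul (ContinuousOn.sub ?_ ?_)).rexp)
    · exact hA.ref_cont.comp c2.continuousOn h2
    · exact hA.ref_cont.comp c1.continuousOn h1
    · exact fun z hz => (hA.ref_pos _ hz.1.1).ne'
    · exact (continuousOn_logRatio hA).comp c2.continuousOn h2
    · exact (continuousOn_logRatio hA).comp c1.continuousOn h1

theorem measurable_moveDensity (hA : A.Regular) {γ : Fin p → ℝ} (hγ : γ ∈ A.varBox) (t : ℝ) :
    Measurable (Function.uncurry (A.moveDensity γ t)) := by
  have h : ContinuousOn (fun z : E p × E p => A.q γ z.1 z.2 * A.acceptOn t z.1 z.2)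
      (A.S ×ˢ A.S) :=
    (continuousOn_q_mul_acceptOn hA).comp (f := fun z : E p × E p => (z, (γ, t))) (by fun_prop)
      fun z hz => ⟨hz, hγ, trivial⟩
  exact (measurable_indicator_of_continuousOn
    ((measurableSet_support hA).prod (measurableSet_support hA)) h).ennreal_ofReal

theorem moveDensity_of_mem (γ : Fin p → ℝ) (t : ℝ) {x y : E p} (hx : x ∈ A.S) (hy : y ∈ A.S) :
    A.moveDensity γ t x y = ENNReal.ofReal (A.q γ x y * A.acceptOn t x y) := by
  rw [moveDensity, Set.indicator_of_mem (Set.mk_mem_prod hx hy)]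

theorem moveDensity_of_notMem (γ : Fin p → ℝ) (t : ℝ) {x y : E p} (h : ¬(x ∈ A.S ∧ y ∈ A.S)) :
    A.moveDensity γ t x y = 0 := by
  rw [moveDensity, Set.indicator_of_notMem (by simpa using h), ENNReal.ofReal_zero]

theorem moveDensity_eq (hA : A.Regular) (γ : Fin p → ℝ) {t : ℝ} (ht : t ∈ A.temps) {x : E p}
    (hx : x ∈ A.S) (y : E p) :
    A.moveDensity γ t x y = ENNReal.ofReal (A.q γ x y * A.accept t x y) := by
  by_cases hy : y ∈ A.S
  · rw [moveDensity_of_mem γ t hx hy, accept_eq hA ht hx hy]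
  · rw [moveDensity_of_notMem γ t (by tauto), accept_eq_zero hA ht hy, mul_zero,
      ENNReal.ofReal_zero]

theorem lintegral_moveDensity_le (hA : A.Regular) {γ : Fin p → ℝ} (hγ : γ ∈ A.varBox) (t : ℝ)
    (x : E p) : ∫⁻ y, A.moveDensity γ t x y ≤ 1 := by
  by_cases hx : x ∈ A.S
  · rw [← hA.q_lintegral γ hγ x hx]
    refine lintegral_mono fun y => ?_
    by_cases hy : y ∈ A.S
    · rw [moveDensity_of_mem γ t hx hy]
      exact ENNReal.ofReal_le_ofReal
        (mul_le_of_le_one_right (hA.q_nonneg γ hγ x hx y) (acceptOn_le_one t x y))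
    · rw [moveDensity_of_notMem γ t (by tauto)]; exact zero_le
  · simp [moveDensity_of_notMem γ t (fun h => hx h.1)]

/-- The integral of rejected proposals is one minus that of accepted ones, because the proposal
density has total mass one. -/
theorem metropolis_eq (hA : A.Regular) {γ : Fin p → ℝ} (hγ : γ ∈ A.varBox) {t : ℝ}
    (ht : t ∈ A.temps) {x : E p} (hx : x ∈ A.S) :
    A.metropolis γ t x = densityKernel volume (A.moveDensity γ t) x := by
  have hd := moveDensity_eq hA γ ht hx
  have hm : Measurable (A.moveDensity γ t x) :=
    (measurable_moveDensity hA hγ t).comp measurable_prodMk_left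
  have h1 : ∫⁻ y, A.moveDensity γ t x y +
      ENNReal.ofReal (A.q γ x y * (1 - A.accept t x y)) = 1 := by
    rw [← hA.q_lintegral γ hγ x hx]
    refine lintegral_congr fun y => ?_
    have ha0 : 0 ≤ A.accept t x y := le_min zero_le_one
      (div_nonneg (tempered_nonneg hA ht y) (tempered_nonneg hA ht x))
    have ha1 : A.accept t x y ≤ 1 := min_le_left _ _
    have hq := hA.q_nonneg γ hγ x hx y
    rw [hd, ← ENNReal.ofReal_add (mul_nonneg hq ha0) (mul_nonneg hq (by linarith)), ← mul_add]
    simp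
  rw [lintegral_add_left hm] at h1
  have h2 : ∫⁻ y, ENNReal.ofReal (A.q γ x y * (1 - A.accept t x y)) =
      1 - ∫⁻ y, A.moveDensity γ t x y := by
    rw [← h1, ENNReal.add_sub_cancel_left]
    exact ((lintegral_moveDensity_le hA hγ t x).trans_lt ENNReal.one_lt_top).ne
  rw [metropolis, densityKernel, h2, ← funext hd]

/-- On `S` both sides are the symmetric proposal density times the minimum of the two tempered
densities; elsewhere both vanish. -/
theorem tempered_mul_moveDensity (hA : A.Regular) {γ : Fin p → ℝ} (hγ : γ ∈ A.varBox) {t : ℝ}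
    (ht : t ∈ A.temps) (x y : E p) :
    ENNReal.ofReal (A.tempered t x) * A.moveDensity γ t x y =
      ENNReal.ofReal (A.tempered t y) * A.moveDensity γ t y x := by
  by_cases h : x ∈ A.S ∧ y ∈ A.S
  · obtain ⟨hx, hy⟩ := h
    have key : ∀ {x y : E p}, x ∈ A.S → y ∈ A.S →
        A.tempered t x * A.accept t x y = min (A.tempered t x) (A.tempered t y) := by
      intro x y hx _
      have hpos : 0 < A.tempered t x := by
        rw [tempered_eq hA t hx]
        exact div_pos (weight_pos hA t hx) (integral_weight_pos hA ht)
      rw [accept, mul_min_of_nonneg _ _ hpos.le, mul_one, mul_div_cancel₀ _ hpos.ne']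
    rw [moveDensity_eq hA γ ht hx, moveDensity_eq hA γ ht hy,
      ← ENNReal.ofReal_mul (tempered_nonneg hA ht x),
      ← ENNReal.ofReal_mul (tempered_nonneg hA ht y), mul_left_comm, key hx hy, mul_left_comm,
      key hy hx, hA.q_symm γ hγ x hx y hy, min_comm]
  · rw [moveDensity_of_notMem γ t h, moveDensity_of_notMem γ t (by tauto), mul_zero, mul_zero]

end Spec

/-! ### Invariance and minorization of the kernel of the positions -/

/-- The positions with all levels from `N` on moved to `z`. -/
noncomputable def freeze {p L : ℕ} (N : ℕ) (z : E p) (x : Fin L → E p) : Fin L → E p :=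
  fun l => if l.val < N then x l else z

theorem measurable_freeze {p L : ℕ} (N : ℕ) (z : E p) :
    Measurable (freeze N z : (Fin L → E p) → Fin L → E p) := by
  refine measurable_pi_lambda _ fun l => ?_
  unfold freeze
  split_ifs
  · exact measurable_pi_apply l
  · exact measurable_const

theorem val_next {L : ℕ} {i : Fin L} (h : i.val + 1 < L) : (next i).val = i.val + 1 := by
  simp [next, h]

namespace Spec

variable {p L : ℕ} {A : Spec p L}

theorem sum_w_le_one (hA : A.Regular) {N : ℕ} (hN : N ≤ L) : ∑ i, A.w N i ≤ 1 := by
  by_cases h : 2 ≤ N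
  · exact (hA.w_sum N h hN).le
  · rw [Finset.sum_eq_zero fun i _ => hA.w_eq_zero N i (by lia)]
    exact zero_le_one

theorem lt_of_w_ne_zero (hA : A.Regular) {N : ℕ} {i : Fin L} (h : A.w N i ≠ 0) :
    i.val + 1 < N := by
  by_contra h'
  exact h (hA.w_eq_zero N i (by lia))

theorem αr_mem_Icc (hA : A.Regular) : A.αr ∈ Set.Icc (0 : ℝ) 1 :=
  Set.Ioc_subset_Icc_self hA.αr_mem

theorem isProbabilityMeasure_levelKernel (hA : A.Regular) (N : ℕ)
    {θ : (Fin L → Fin p → ℝ) × (Fin L → ℝ)} (hθ : θ ∈ A.params) (l : Fin L) (x : E p) :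
    IsProbabilityMeasure (A.levelKernel N θ l x) := by
  unfold levelKernel
  split_ifs
  · exact isProbabilityMeasure_densityKernel (lintegral_moveDensity_le hA (hθ l).1 _) x
  · infer_instance

theorem measurable_levelKernel (hA : A.Regular) (N : ℕ)
    {θ : (Fin L → Fin p → ℝ) × (Fin L → ℝ)} (hθ : θ ∈ A.params) (l : Fin L) :
    Measurable (A.levelKernel N θ l) := by
  unfold levelKernel
  split_ifs
  · exact measurable_densityKernel (measurable_moveDensity hA (hθ l).1 _)
  · exact Measure.measurable_dirac

theorem isProbabilityMeasure_chainKernel (hA : A.Regular) {N : ℕ} (hN : N ≤ L)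
    {θ : (Fin L → Fin p → ℝ) × (Fin L → ℝ)} (hθ : θ ∈ A.params) (x : Fin L → E p) :
    IsProbabilityMeasure (A.chainKernel N θ x) :=
  have := isProbabilityMeasure_levelKernel hA N hθ
  isProbabilityMeasure_temperingKernel (αr_mem_Icc hA) (hA.w_nonneg N) (sum_w_le_one hA hN)
    (exchangeOn_mem θ.2) x

theorem measurable_chainKernel (hA : A.Regular) (N : ℕ)
    {θ : (Fin L → Fin p → ℝ) × (Fin L → ℝ)} (hθ : θ ∈ A.params) :
    Measurable (A.chainKernel N θ) :=
  have := isProbabilityMeasure_levelKernel hA N hθ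
  measurable_temperingKernel (measurable_levelKernel hA N hθ) (measurable_exchangeOn hA θ.2)

theorem parallelLaw_eq (hA : A.Regular) (N : ℕ) {θ : (Fin L → Fin p → ℝ) × (Fin L → ℝ)}
    (hθ : θ ∈ A.params) {x : Fin L → E p} (hx : ∀ l, x l ∈ A.S) :
    A.parallelLaw N θ.1 θ.2 x = Measure.pi fun l => A.levelKernel N θ l (x l) := by
  unfold parallelLaw levelKernel
  congr 1
  ext1 l
  rw [metropolis_eq hA (hθ l).1 (hθ l).2 (hx l)]

/-- On the support, the positions move by `chainKernel`. -/
theorem stepLaw_real_snd (hA : A.Regular) (N : ℕ) {θ : (Fin L → Fin p → ℝ) × (Fin L → ℝ)}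
    (hθ : θ ∈ A.params) {x : Fin L → E p} (hx : ∀ l, x l ∈ A.S) {B : Set (Fin L → E p)}
    (hB : MeasurableSet B) :
    (A.stepLaw N θ.1 θ.2 x).real (Prod.snd ⁻¹' B) = (A.chainKernel N θ x).real B := by
  have hB' : MeasurableSet (Prod.snd ⁻¹' B : Set (Move L × (Fin L → E p))) := measurable_snd hB
  have hm : Measurable fun y : Fin L → E p => ((Move.parallel : Move L), y) :=
    measurable_prodMk_left
  have hind : ∀ (a : Move L) (y : Fin L → E p),
      (Prod.snd ⁻¹' B : Set (Move L × (Fin L → E p))).indicator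
        (1 : Move L × (Fin L → E p) → ENNReal) (a, y) =
        B.indicator 1 y := fun a y => by by_cases hy : y ∈ B <;> simp [hy]
  rw [measureReal_def, measureReal_def, chainKernel, temperingKernel_apply _ hB, stepLaw,
    parallelLaw_eq hA N hθ hx]
  simp only [Measure.add_apply, Measure.smul_apply, smul_eq_mul, Measure.finsetSum_apply,
    Measure.dirac_apply' _ hB', hind, Measure.map_apply hm hB', exchangeProb_eq hA
      (fun l => (hθ l).2) hx]
  rfl

/-- Removed levels do not move and belong to no pair of positive weight, so they can be placed at
`z` before or after the step. Replacing their random positions by one point is what makes a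
minorization possible. -/
theorem chainKernel_freeze (hA : A.Regular) {N : ℕ} (hN : N ≤ L)
    {θ : (Fin L → Fin p → ℝ) × (Fin L → ℝ)} (hθ : θ ∈ A.params) (z : E p) (x : Fin L → E p)
    {B : Set (Fin L → E p)} (hB : MeasurableSet B) :
    (A.chainKernel N θ x).real (freeze N z ⁻¹' B) = (A.chainKernel N θ (freeze N z x)).real B := by
  have hp := isProbabilityMeasure_levelKernel hA N hθ
  have hfm := measurable_freeze (L := L) N z
  have h1 : (Measure.pi fun l => A.levelKernel N θ l (x l)) (freeze N z ⁻¹' B) =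
      (Measure.pi fun l => A.levelKernel N θ l (freeze N z x l)) B := by
    have hcm : ∀ l : Fin L, Measurable fun y : E p => if l.val < N then y else z := fun l => by
      split_ifs
      · exact measurable_id
      · exact measurable_const
    have hmap : ∀ l : Fin L, (A.levelKernel N θ l (x l)).map
        (fun y : E p => if l.val < N then y else z) = A.levelKernel N θ l (freeze N z x l) :=
      fun l => by
        by_cases hl : l.val < N
        · simp [hl, freeze]
        · simp only [levelKernel, hl, if_false, freeze]
          rw [Measure.map_dirac' measurable_const]
    have hpm : ∀ l : Fin L, IsProbabilityMeasure ((A.levelKernel N θ l (x l)).map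
        (fun y : E p => if l.val < N then y else z)) := fun l =>
      Measure.isProbabilityMeasure_map (hcm l).aemeasurable
    rw [← Measure.map_apply hfm hB]
    have := Measure.pi_map_pi (μ := fun l => A.levelKernel N θ l (x l))
      (f := fun (l : Fin L) (y : E p) => if l.val < N then y else z)
      fun l => (hcm l).aemeasurable
    simp only [hmap] at this
    rw [← this]
    rfl
  have hind : ∀ y : Fin L → E p, (freeze N z ⁻¹' B).indicator
      (1 : (Fin L → E p) → ENNReal) y =
      B.indicator 1 (freeze N z y) := fun y => by
    by_cases hy : freeze N z y ∈ B <;> simp [hy]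
  rw [measureReal_def, measureReal_def, chainKernel, temperingKernel_apply _ (hfm hB),
    temperingKernel_apply _ hB, h1]
  simp only [hind]
  congr 4
  refine Finset.sum_congr rfl fun i _ => ?_
  rcases eq_or_ne (A.w N i) 0 with h0 | h0
  · simp [h0]
  have hi := lt_of_w_ne_zero hA h0
  have hn := val_next (i := i) (by lia)
  -- Both `i` and `next i` are below `N`, so the swap does not mix remaining and removed levels.
  have h2 : freeze N z (x ∘ Equiv.swap i (next i)) = freeze N z x ∘ Equiv.swap i (next i) := by
    ext1 l
    simp only [freeze, Function.comp]
    rcases eq_or_ne l i with rfl | hli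
    · rw [Equiv.swap_apply_left, if_pos (by lia), if_pos (by lia)]
    rcases eq_or_ne l (next i) with rfl | hln
    · rw [Equiv.swap_apply_right, if_pos (by lia), if_pos (by lia)]
    · rw [Equiv.swap_apply_of_ne_of_ne hli hln]
  have h3 : A.exchangeOn θ.2 i (freeze N z x) = A.exchangeOn θ.2 i x := by
    simp only [exchangeOn, freeze]
    rw [if_pos (by lia), if_pos (by lia)]
  rw [h2, h3]

theorem isProbabilityMeasure_chainTarget (hA : A.Regular) (N : ℕ) (z : E p) {t : Fin L → ℝ}
    (ht : ∀ l, t l ∈ A.temps) : IsProbabilityMeasure (A.chainTarget N z t) := by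
  unfold chainTarget
  have : ∀ l : Fin L, IsProbabilityMeasure
      (if l.val < N then A.temperedMeasure (t l) else Measure.dirac z) := fun l => by
    split_ifs
    · exact isProbabilityMeasure_temperedMeasure hA (ht l)
    · infer_instance
  infer_instance

/-- When both positions lie in `S`, each side is the minimum of the two product densities, before
and after the swap; otherwise each side vanishes. -/
theorem exchangeOn_mul_tempered (hA : A.Regular) {t : Fin L → ℝ} (ht : ∀ l, t l ∈ A.temps)
    (i : Fin L) (x : Fin L → E p) :
    A.exchangeOn t i (x ∘ Equiv.swap i (next i)) *
        (A.tempered (t i) (x (next i)) * A.tempered (t (next i)) (x i)) =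
      A.exchangeOn t i x * (A.tempered (t i) (x i) * A.tempered (t (next i)) (x (next i))) := by
  by_cases hx : x i ∈ A.S ∧ x (next i) ∈ A.S
  · obtain ⟨hi, hj⟩ := hx
    simp only [exchangeOn, Function.comp, Equiv.swap_apply_left, Equiv.swap_apply_right]
    set a := A.tempered (t i) (x i) * A.tempered (t (next i)) (x (next i)) with ha
    set d := (t i - t (next i)) * (A.logRatio (x (next i)) - A.logRatio (x i)) with hd
    have ha0 : 0 ≤ a := mul_nonneg (tempered_nonneg hA (ht _) _) (tempered_nonneg hA (ht _) _)
    have hb : A.tempered (t i) (x (next i)) * A.tempered (t (next i)) (x i) = a * Real.exp d := by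
      have e : d = t i * A.logRatio (x (next i)) + t (next i) * A.logRatio (x i) -
          (t i * A.logRatio (x i) + t (next i) * A.logRatio (x (next i))) := by rw [hd]; ring
      rw [ha, e, Real.exp_sub, Real.exp_add, Real.exp_add]
      simp only [tempered_eq hA _ hi, tempered_eq hA _ hj, weight]
      have h1 := (integral_weight_pos hA (ht i)).ne'
      have h2 := (integral_weight_pos hA (ht (next i))).ne'
      generalize (∫ y, A.dens y ^ t i * A.ref y ^ (1 - t i)) = Z at h1 ⊢
      generalize (∫ y, A.dens y ^ t (next i) * A.ref y ^ (1 - t (next i))) = Z' at h2 ⊢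
      field_simp
    have hd' : (t i - t (next i)) * (A.logRatio (x i) - A.logRatio (x (next i))) = -d := by
      rw [hd]; ring
    rw [hb, hd', min_mul_of_nonneg _ _ (mul_nonneg ha0 (Real.exp_pos _).le),
      min_mul_of_nonneg _ _ ha0, one_mul, one_mul, mul_left_comm, ← Real.exp_add,
      neg_add_cancel, Real.exp_zero, mul_one, min_comm, mul_comm a]
  · have : ∀ s t', s ∈ A.temps → t' ∈ A.temps → A.tempered s (x i) * A.tempered t' (x (next i)) = 0 :=
      fun s t' hs ht' => by
        rcases not_and_or.1 hx with h | h
        · rw [tempered_eq_zero hA hs h, zero_mul]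
        · rw [tempered_eq_zero hA ht' h, mul_zero]
    rw [this _ _ (ht _) (ht _), mul_comm (A.tempered (t i) _), this _ _ (ht _) (ht _), mul_zero,
      mul_zero]

/-- Remaining levels are reversible Metropolis chains, removed levels stay where they are, and
exchanges are in detailed balance. For the exchanges, densities are taken relative to Lebesgue
measure on remaining levels and to the point mass on removed ones; an exchanged pair always has
equal base measures. -/
theorem chainTarget_bind (hA : A.Regular) {N : ℕ} (hN : N ≤ L)
    {θ : (Fin L → Fin p → ℝ) × (Fin L → ℝ)} (hθ : θ ∈ A.params) (z : E p) :
    (A.chainTarget N z θ.2).bind (A.chainKernel N θ) = A.chainTarget N z θ.2 := by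
  classical
  have hk := isProbabilityMeasure_levelKernel hA N hθ
  have hlm : ∀ l, θ.2 l ∈ A.temps := fun l => (hθ l).2
  have hp : ∀ l : Fin L, IsProbabilityMeasure
      (if l.val < N then A.temperedMeasure (θ.2 l) else Measure.dirac z) := fun l => by
    split_ifs
    · exact isProbabilityMeasure_temperedMeasure hA (hlm l)
    · infer_instance
  unfold chainTarget chainKernel
  refine measurePi_bind_temperingKernel (αr_mem_Icc hA) (hA.w_nonneg N) (sum_w_le_one hA hN)
    (measurable_levelKernel hA N hθ) (measurable_exchangeOn hA θ.2) (exchangeOn_mem θ.2)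
    (fun l => ?_) fun i hi B hB => ?_
  · unfold levelKernel
    by_cases hl : l.val < N
    · simp only [hl, if_true]
      exact withDensity_bind_densityKernel (measurable_moveDensity hA (hθ l).1 _)
        (lintegral_moveDensity_le hA (hθ l).1 _) (measurable_tempered hA (hlm l)).ennreal_ofReal
        (tempered_mul_moveDensity hA (hθ l).1 (hlm l))
    · simp only [hl, if_false]
      exact Measure.bind_dirac
  · have hiN := lt_of_w_ne_zero hA hi
    have hn := val_next (i := i) (by lia)
    set base : Fin L → Measure (E p) := fun l => if l.val < N then volume else Measure.dirac z
      with hbase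
    set f : Fin L → E p → ENNReal := fun l =>
      if l.val < N then fun x => ENNReal.ofReal (A.tempered (θ.2 l) x) else 1 with hf
    have hbf : (fun l : Fin L => if l.val < N then A.temperedMeasure (θ.2 l)
        else Measure.dirac z) = fun l => (base l).withDensity (f l) := by
      ext1 l
      by_cases hl : l.val < N <;> simp [hbase, hf, hl, temperedMeasure]
    have hsb : ∀ l, SigmaFinite (base l) := fun l => by
      simp only [hbase]; split_ifs <;> infer_instance
    have hsf : ∀ l, SigmaFinite ((base l).withDensity (f l)) := fun l => by
      rw [← congrFun hbf l]
      have := hp l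
      infer_instance
    have hi1 : i.val < N := by lia
    have hj1 : (next i).val < N := by lia
    have h := lintegral_swap_eq (base := base) (f := f) (fun l => ?_) (i := i) (j := next i)
      (fun h => by have := congrArg Fin.val h; lia) (by simp only [hbase, hi1, hj1])
      (measurable_exchangeOn hA θ.2 i).ennreal_ofReal (fun x => ?_) hB
    · rw [← hbf] at h
      exact h
    · simp only [hf]
      split_ifs
      · exact (measurable_tempered hA (hlm l)).ennreal_ofReal
      · exact measurable_one
    · simp only [hf, hi1, hj1, if_true]
      have hnn := fun l y => tempered_nonneg hA (hlm l) y
      rw [← ENNReal.ofReal_mul (hnn _ _), ← ENNReal.ofReal_mul (hnn _ _),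
        ← ENNReal.ofReal_mul (exchangeOn_mem _ _ _).1,
        ← ENNReal.ofReal_mul (exchangeOn_mem _ _ _).1, exchangeOn_mul_tempered hA hlm]

theorem chainTarget_real_eval (hA : A.Regular) {N : ℕ} (z : E p) {t : Fin L → ℝ}
    (ht : ∀ l, t l ∈ A.temps) {l : Fin L} (hl : l.val < N) (hl1 : t l = 1) {B : Set (E p)}
    (hB : MeasurableSet B) :
    (A.chainTarget N z t).real (Function.eval l ⁻¹' B) = A.target.real B := by
  have hp : ∀ l : Fin L, IsProbabilityMeasure
      (if l.val < N then A.temperedMeasure (t l) else Measure.dirac z) := fun l => by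
    split_ifs
    · exact isProbabilityMeasure_temperedMeasure hA (ht l)
    · infer_instance
  rw [chainTarget, ← map_measureReal_apply (measurable_pi_apply l) hB]
  have := (measurePreserving_eval (fun l : Fin L => if l.val < N then A.temperedMeasure (t l)
    else Measure.dirac z) l).map_eq
  simp only [hl, if_true, hl1, temperedMeasure_one hA] at this
  rw [← this]

theorem ae_mem_chainTarget (hA : A.Regular) (N : ℕ) {z : E p} (hz : z ∈ A.S) {t : Fin L → ℝ}
    (ht : ∀ l, t l ∈ A.temps) :
    ∀ᵐ x ∂A.chainTarget N z t, (∀ l, x l ∈ A.S) ∧ ∀ l : Fin L, N ≤ l.val → x l = z := by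
  have hp : ∀ l : Fin L, IsProbabilityMeasure
      (if l.val < N then A.temperedMeasure (t l) else Measure.dirac z) := fun l => by
    split_ifs
    · exact isProbabilityMeasure_temperedMeasure hA (ht l)
    · infer_instance
  have key : ∀ l : Fin L, ∀ᵐ y ∂(if l.val < N then A.temperedMeasure (t l) else Measure.dirac z),
      y ∈ A.S ∧ (N ≤ l.val → y = z) := fun l => by
    split_ifs with hl
    · filter_upwards [ae_mem_support_temperedMeasure hA (ht l)] with y hy
      exact ⟨hy, fun h => absurd hl (by lia)⟩
    · have : MeasurableSet {y : E p | y ∈ A.S ∧ (N ≤ l.val → y = z)} := by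
        have hN : N ≤ l.val := by lia
        simp only [hN, true_imp_iff]
        exact (measurableSet_support hA).inter (measurableSet_singleton z)
      rw [ae_dirac_iff this]
      exact ⟨hz, fun _ => rfl⟩
  have h : ∀ᵐ x ∂A.chainTarget N z t, ∀ l, x l ∈ A.S ∧ (N ≤ l.val → x l = z) :=
    ae_all_iff.2 fun l => (Measure.tendsto_eval_ae_ae (μ := fun l : Fin L =>
      if l.val < N then A.temperedMeasure (t l) else Measure.dirac z)).eventually (key l)
  exact h.mono fun x hx => ⟨fun l => (hx l).1, fun l => (hx l).2⟩

/-- Minorization of the kernels of the positions, uniformly in the parameters. -/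
theorem exists_minorization (hA : A.Regular) : ∃ β : ℝ, 0 < β ∧ β ≤ 1 ∧
    ∀ N, ∀ θ ∈ A.params, ∀ z : E p, ∃ m : Measure (Fin L → E p), IsFiniteMeasure m ∧
      β ≤ m.real Set.univ ∧
      ∀ x ∈ {x : Fin L → E p | (∀ l, x l ∈ A.S) ∧ ∀ l : Fin L, N ≤ l.val → x l = z},
        m ≤ A.chainKernel N θ x := by
  classical
  obtain ⟨M, hM⟩ := exists_temps_subset hA
  have hbox : IsCompact A.varBox := isCompact_univ_pi fun _ => isCompact_Icc
  -- A positive continuous function on a compact set. The whole interval `[0, M]` is admitted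
  -- because the temperatures need be neither closed nor bounded away from `0`.
  obtain ⟨c, hc0, hc⟩ := ((hA.compact.prod hA.compact).prod
    (hbox.prod (isCompact_Icc (a := (0 : ℝ)) (b := M)))).exists_forall_le'
    ((continuousOn_q_mul_acceptOn hA).mono
      (Set.prod_mono_right (Set.prod_mono_right (Set.subset_univ _)))) (a := 0) (by
        rintro z ⟨⟨hx, hy⟩, hγ, -⟩
        exact mul_pos (hA.q_pos _ hγ _ hx _ hy) (lt_min one_pos
          (mul_pos (div_pos (hA.ref_pos _ hy) (hA.ref_pos _ hx)) (Real.exp_pos _))))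
  have hfin : IsFiniteMeasure ((volume : Measure (E p)).restrict A.S) :=
    ⟨by simpa using hA.compact.measure_lt_top⟩
  have hv : 0 < (volume : Measure (E p)).real A.S :=
    ENNReal.toReal_pos (volume_support_pos hA).ne' hA.compact.measure_lt_top.ne
  -- A remaining level contributes mass `c * volume S`, a removed one mass `1`; `b` bounds both, so
  -- that `b ^ L` serves for every `N`.
  set b := min 1 (c * (volume : Measure (E p)).real A.S) with hb
  have hb0 : 0 < b := lt_min one_pos (mul_pos hc0 hv)
  refine ⟨A.αr * b ^ L, mul_pos hA.αr_mem.1 (pow_pos hb0 _),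
    mul_le_one₀ hA.αr_mem.2 (pow_nonneg hb0.le _) (pow_le_one₀ hb0.le (min_le_left _ _)),
    fun N θ hθ z => ?_⟩
  set m : Fin L → Measure (E p) := fun l =>
    if l.val < N then ENNReal.ofReal c • (volume : Measure (E p)).restrict A.S
      else Measure.dirac z with hm
  have hmf : ∀ l, IsFiniteMeasure (m l) := fun l => by
    simp only [hm]
    split_ifs
    · exact Measure.smul_finite _ ENNReal.ofReal_ne_top
    · infer_instance
  have hml : ∀ l, b ≤ (m l).real Set.univ := fun l => by
    simp only [hm]
    split_ifs
    · rw [measureReal_ennreal_smul_apply, ENNReal.toReal_ofReal hc0.le, measureReal_restrict_apply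
        .univ, Set.univ_inter]
      exact min_le_right _ _
    · rw [probReal_univ]
      exact min_le_left _ _
  refine ⟨ENNReal.ofReal A.αr • Measure.pi m, Measure.smul_finite _ ENNReal.ofReal_ne_top, ?_,
    fun x hx => smul_measurePi_le_temperingKernel fun l => ?_⟩
  · rw [measureReal_ennreal_smul_apply, ENNReal.toReal_ofReal hA.αr_mem.1.le, measureReal_def,
      Measure.pi_univ, ENNReal.toReal_prod]
    refine mul_le_mul_of_nonneg_left ?_ hA.αr_mem.1.le
    calc b ^ L = ∏ _l : Fin L, b := by simp
      _ ≤ _ := Finset.prod_le_prod (fun _ _ => hb0.le) fun l _ => hml l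
  · simp only [hm, levelKernel]
    split_ifs with hl
    · refine smul_restrict_le_densityKernel (measurableSet_support hA) fun y hy => ?_
      rw [moveDensity_of_mem _ _ (hx.1 l) hy]
      exact ENNReal.ofReal_le_ofReal
        (hc ((x l, y), (θ.1 l, θ.2 l)) ⟨⟨hx.1 l, hy⟩, (hθ l).1, hM (hθ l).2⟩)
    · rw [hx.2 l (by lia)]

end Spec

/-! ### Uniform continuity of the kernels in the parameters -/

namespace Spec

variable {p L : ℕ} {A : Spec p L}

/-- Uniform continuity on the compact set of positions in `S`, variances in the box and temperatures
in `[0, M]`. -/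
theorem exists_uniform_moveDensity (hA : A.Regular) {ε : ℝ} (hε : 0 < ε) : ∃ δ > 0,
    ∀ γ ∈ A.varBox, ∀ γ' ∈ A.varBox, ∀ t ∈ A.temps, ∀ t' ∈ A.temps, dist γ γ' < δ → dist t t' < δ →
      ∀ x y, A.moveDensity γ t x y ≤
        A.moveDensity γ' t' x y + A.S.indicator (fun _ => ENNReal.ofReal ε) y := by
  obtain ⟨M, hM⟩ := exists_temps_subset hA
  have hbox : IsCompact A.varBox := isCompact_univ_pi fun _ => isCompact_Icc
  have hu := ((hA.compact.prod hA.compact).prod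
    (hbox.prod (isCompact_Icc (a := (0 : ℝ)) (b := M)))).uniformContinuousOn_of_continuous
    ((continuousOn_q_mul_acceptOn hA).mono
      (Set.prod_mono_right (Set.prod_mono_right (Set.subset_univ _))))
  obtain ⟨δ, hδ, h⟩ := Metric.uniformContinuousOn_iff.1 hu ε hε
  refine ⟨δ, hδ, fun γ hγ γ' hγ' t ht t' ht' h1 h2 x y => ?_⟩
  by_cases hxy : x ∈ A.S ∧ y ∈ A.S
  · obtain ⟨hx, hy⟩ := hxy
    have := h ((x, y), (γ, t)) ⟨⟨hx, hy⟩, hγ, hM ht⟩ ((x, y), (γ', t')) ⟨⟨hx, hy⟩, hγ', hM ht'⟩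
      (by
        rw [Prod.dist_eq, dist_self, max_eq_right dist_nonneg, Prod.dist_eq]
        exact max_lt h1 h2)
    rw [moveDensity_of_mem _ _ hx hy, moveDensity_of_mem _ _ hx hy, Set.indicator_of_mem hy,
      ← ENNReal.ofReal_add (mul_nonneg (hA.q_nonneg _ hγ' _ hx _) (acceptOn_nonneg hA _ hx hy))
        hε.le]
    refine ENNReal.ofReal_le_ofReal ?_
    have := (abs_lt.1 this).2
    linarith
  · rw [moveDensity_of_notMem _ _ hxy]
    exact zero_le

theorem exists_uniform_exchangeOn (hA : A.Regular) {ε : ℝ} (hε : 0 < ε) : ∃ δ > 0,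
    ∀ t t' : Fin L → ℝ, (∀ l, t l ∈ A.temps) → (∀ l, t' l ∈ A.temps) → dist t t' < δ →
      ∀ x : Fin L → E p, (∀ l, x l ∈ A.S) → ∀ i, |A.exchangeOn t i x - A.exchangeOn t' i x| ≤ ε := by
  obtain ⟨M, hM⟩ := exists_temps_subset hA
  have hc : ContinuousOn (fun z : (E p × E p) × (ℝ × ℝ) =>
      min 1 (Real.exp ((z.2.1 - z.2.2) * (A.logRatio z.1.2 - A.logRatio z.1.1))))
      ((A.S ×ˢ A.S) ×ˢ (Set.Icc 0 M ×ˢ Set.Icc 0 M)) := by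
    have c1 : Continuous fun z : (E p × E p) × (ℝ × ℝ) => z.1.1 := by fun_prop
    have c2 : Continuous fun z : (E p × E p) × (ℝ × ℝ) => z.1.2 := by fun_prop
    have c3 : Continuous fun z : (E p × E p) × (ℝ × ℝ) => z.2.1 - z.2.2 := by fun_prop
    refine ContinuousOn.inf continuousOn_const
      (c3.continuousOn.mul (ContinuousOn.sub ?_ ?_)).rexp
    · exact (continuousOn_logRatio hA).comp c2.continuousOn fun z hz => hz.1.2
    · exact (continuousOn_logRatio hA).comp c1.continuousOn fun z hz => hz.1.1
  have hu := ((hA.compact.prod hA.compact).prod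
    (isCompact_Icc.prod isCompact_Icc)).uniformContinuousOn_of_continuous hc
  obtain ⟨δ, hδ, h⟩ := Metric.uniformContinuousOn_iff.1 hu ε hε
  refine ⟨δ, hδ, fun t t' ht ht' htt x hx i => ?_⟩
  have := h ((x i, x (next i)), (t i, t (next i))) ⟨⟨hx _, hx _⟩, hM (ht _), hM (ht _)⟩
    ((x i, x (next i)), (t' i, t' (next i))) ⟨⟨hx _, hx _⟩, hM (ht' _), hM (ht' _)⟩ (by
      rw [Prod.dist_eq, dist_self, max_eq_right dist_nonneg, Prod.dist_eq]
      exact max_lt ((dist_le_pi_dist _ _ _).trans_lt htt) ((dist_le_pi_dist _ _ _).trans_lt htt))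
  exact this.le

/-- The densities are brought within `ε / volume S` on `S`, so the overlap loses at most `ε`.
Closeness is expressed by an overlap because overlaps multiply in product measures. -/
theorem exists_common_levelKernel (hA : A.Regular) {ε : ℝ} (hε : 0 < ε) : ∃ δ > 0,
    ∀ N, ∀ θ ∈ A.params, ∀ θ' ∈ A.params, dist θ θ' < δ → ∀ (l : Fin L) (x : E p),
      ∃ η : Measure (E p), η ≤ A.levelKernel N θ l x ∧ η ≤ A.levelKernel N θ' l x ∧
        1 - ε ≤ η.real Set.univ := by
  set v := (volume : Measure (E p)).real A.S with hv
  have hv0 : 0 < v :=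
    ENNReal.toReal_pos (volume_support_pos hA).ne' hA.compact.measure_lt_top.ne
  obtain ⟨δ, hδ, h⟩ := exists_uniform_moveDensity hA (div_pos hε hv0)
  refine ⟨δ, hδ, fun N θ hθ θ' hθ' hd l x => ?_⟩
  by_cases hl : l.val < N
  · simp only [levelKernel, hl, if_true]
    have hd1 : dist (θ.1 l) (θ'.1 l) < δ :=
      (dist_le_pi_dist _ _ l).trans_lt ((le_max_left _ _).trans_lt hd)
    have hd2 : dist (θ.2 l) (θ'.2 l) < δ :=
      (dist_le_pi_dist _ _ l).trans_lt ((le_max_right _ _).trans_lt hd)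
    have hm := fun {γ} (hγ : γ ∈ A.varBox) t x =>
      (measurable_moveDensity hA hγ t).comp (measurable_prodMk_left (x := x))
    obtain ⟨η, h1, h2, h3⟩ := exists_common_densityKernel (lam := volume)
      (k := A.moveDensity (θ.1 l) (θ.2 l)) (k' := A.moveDensity (θ'.1 l) (θ'.2 l))
      (g := A.S.indicator fun _ => ENNReal.ofReal (ε / v)) (δ := ENNReal.ofReal ε)
      (hm (hθ l).1 (θ.2 l)) (hm (hθ' l).1 (θ'.2 l))
      (lintegral_moveDensity_le hA (hθ l).1 _) (lintegral_moveDensity_le hA (hθ' l).1 _)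
      (by
        rw [lintegral_indicator_const (measurableSet_support hA), ← ofReal_measureReal
          (h := hA.compact.measure_lt_top.ne), ← ENNReal.ofReal_mul (div_pos hε hv0).le,
          div_mul_cancel₀ _ hv0.ne'])
      x (h _ (hθ l).1 _ (hθ' l).1 _ (hθ l).2 _ (hθ' l).2 hd1 hd2 x)
      (h _ (hθ' l).1 _ (hθ l).1 _ (hθ' l).2 _ (hθ l).2 (by rwa [dist_comm]) (by rwa [dist_comm]) x)
    refine ⟨η, h1, h2, ?_⟩
    have := isProbabilityMeasure_densityKernel (lintegral_moveDensity_le hA (hθ l).1 (θ.2 l)) x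
    have : IsFiniteMeasure η := isFiniteMeasure_of_le _ h1
    rw [← ofReal_measureReal (μ := η), ← ENNReal.ofReal_add measureReal_nonneg hε.le,
      ← ENNReal.ofReal_one] at h3
    have := (ENNReal.ofReal_le_ofReal_iff (by positivity)).1 h3
    linarith
  · simp only [levelKernel, hl, if_false]
    exact ⟨Measure.dirac x, le_rfl, le_rfl, by rw [probReal_univ]; linarith⟩

/-- The kernels of the positions depend on the parameters uniformly continuously in total
variation, uniformly on the support. -/
theorem exists_uniform_chainKernel (hA : A.Regular) {ε : ℝ} (hε : 0 < ε) : ∃ δ > 0,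
    ∀ N ≤ L, ∀ θ ∈ A.params, ∀ θ' ∈ A.params, dist θ θ' < δ →
      ∀ x : Fin L → E p, (∀ l, x l ∈ A.S) → ∀ B, MeasurableSet B →
        |(A.chainKernel N θ x).real B - (A.chainKernel N θ' x).real B| ≤ ε := by
  -- The parallel step costs `L * ε₁` and the exchange `2 * ε₁`; the cap at `1` is needed for
  -- Bernoulli's inequality.
  set ε₁ := min 1 (ε / (L + 2)) with hε₁
  have hε₁0 : 0 < ε₁ := lt_min one_pos (by positivity)
  have hε₁' : L * ε₁ + 2 * ε₁ ≤ ε := by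
    rw [← add_mul]
    calc ((L : ℝ) + 2) * ε₁ ≤ (L + 2) * (ε / (L + 2)) := by gcongr; exact min_le_right _ _
      _ = ε := by field_simp
  obtain ⟨δ₁, hδ₁, h₁⟩ := exists_common_levelKernel hA hε₁0
  obtain ⟨δ₂, hδ₂, h₂⟩ := exists_uniform_exchangeOn hA hε₁0
  have key : ∀ N ≤ L, ∀ θ ∈ A.params, ∀ θ' ∈ A.params, dist θ θ' < min δ₁ δ₂ →
      ∀ x : Fin L → E p, (∀ l, x l ∈ A.S) → ∀ B, MeasurableSet B →
        (A.chainKernel N θ x).real B ≤ (A.chainKernel N θ' x).real B + ε := by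
    intro N hN θ hθ θ' hθ' hd x hx B hB
    have hp := isProbabilityMeasure_levelKernel hA N hθ
    have hp' := isProbabilityMeasure_levelKernel hA N hθ'
    choose η hη hη' hηu using fun l => h₁ N θ hθ θ' hθ' (hd.trans_le (min_le_left _ _)) l (x l)
    have hpar := measurePi_real_le_of_common hη hη' (min_le_left _ _) hηu hB
    rw [Fintype.card_fin] at hpar
    have := temperingKernel_real_le (r := A.αr) (w := A.w N) (αr_mem_Icc hA) (hA.w_nonneg N)
      (sum_w_le_one hA hN) (exchangeOn_mem θ.2) (exchangeOn_mem θ'.2) x hB (by positivity)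
      hε₁0.le hpar (h₂ θ.2 θ'.2 (fun l => (hθ l).2) (fun l => (hθ' l).2)
        ((le_max_right _ _).trans_lt (hd.trans_le (min_le_right _ _))) x hx)
    exact this.trans (by unfold chainKernel; linarith)
  refine ⟨min δ₁ δ₂, lt_min hδ₁ hδ₂, fun N hN θ hθ θ' hθ' hd x hx B hB => abs_le.2 ⟨?_, ?_⟩⟩
  · have := key N hN θ' hθ' θ hθ (by rwa [dist_comm]) x hx B hB
    linarith
  · have := key N hN θ hθ θ' hθ' hd x hx B hB
    linarith

end Spec

/-! ### Elementary properties of a single iteration -/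

theorem newCount_le {L : ℕ} (d N : ℕ) (cnt : Fin L → ℕ) : newCount d N cnt ≤ N := by
  unfold newCount
  split_ifs with h
  · obtain ⟨l, hl, hd⟩ := h
    exact (Nat.sInf_le (show l.val + 1 ∈ {k : ℕ | ∃ l : Fin L, l.val < N ∧ d ≤ cnt l ∧
      k = l.val + 1} from ⟨l, hl, hd, rfl⟩)).trans hl
  · exact le_rfl

theorem one_le_newCount {L : ℕ} {d N : ℕ} {cnt : Fin L → ℕ} (hN : 1 ≤ N) :
    1 ≤ newCount d N cnt := by
  unfold newCount
  split_ifs with h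
  · obtain ⟨l, hl, hd⟩ := h
    obtain ⟨l', -, -, h'⟩ := Nat.sInf_mem
      (⟨_, l, hl, hd, rfl⟩ : {k : ℕ | ∃ l : Fin L, l.val < N ∧ d ≤ cnt l ∧ k = l.val + 1}.Nonempty)
    lia
  · exact hN

/-- From `exp u - exp v = exp u * (1 - exp (v - u))` and `1 - exp s ≤ -s`. It passes from increments
of `ζ` to increments of the temperatures. -/
theorem abs_exp_sub_exp_le {u v M : ℝ} (hu : Real.exp u ≤ M) (hv : Real.exp v ≤ M) :
    |Real.exp u - Real.exp v| ≤ M * |u - v| := by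
  have key : ∀ {u v : ℝ}, Real.exp u ≤ M → Real.exp u - Real.exp v ≤ M * |u - v| := by
    intro u v hu
    have h1 := Real.add_one_le_exp (v - u)
    have h2 : Real.exp v = Real.exp u * Real.exp (v - u) := by rw [← Real.exp_add]; ring_nf
    have h3 := Real.exp_pos u
    calc Real.exp u - Real.exp v = Real.exp u * (1 - Real.exp (v - u)) := by rw [h2]; ring
      _ ≤ Real.exp u * |u - v| := by gcongr; linarith [le_abs_self (u - v)]
      _ ≤ M * |u - v| := by gcongr
  refine abs_le.2 ⟨?_, key hu⟩
  have := key (v := u) hv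
  rw [abs_sub_comm] at this
  linarith

/-- The weight of such a pair is zero. Hence `next` is only ever used where it really is the
following level. -/
theorem Spec.stepLaw_real_exchange_eq_zero {p L : ℕ} {A : Spec p L} (hA : A.Regular) {N : ℕ}
    {i : Fin L} (hi : N ≤ i.val + 1) (γ : Fin L → Fin p → ℝ) (t : Fin L → ℝ) (x : Fin L → E p) :
    (A.stepLaw N γ t x).real {z | ∃ acc, z.1 = Move.exchange i acc} = 0 := by
  have hB : MeasurableSet {z : Move L × (Fin L → E p) | ∃ acc, z.1 = Move.exchange i acc} :=
    measurable_fst (t := {a : Move L | ∃ acc, a = Move.exchange i acc}) trivial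
  have hm : Measurable fun y : Fin L → E p => ((Move.parallel : Move L), y) :=
    measurable_prodMk_left
  rw [measureReal_def, stepLaw]
  simp only [Measure.add_apply, Measure.smul_apply, smul_eq_mul, Measure.finsetSum_apply,
    Measure.dirac_apply' _ hB, Measure.map_apply hm hB]
  have h0 := hA.w_eq_zero N i hi
  have hs : ∀ k, ENNReal.ofReal (A.w N k) * (ENNReal.ofReal (A.exchangeProb t x k) *
      Set.indicator {z : Move L × (Fin L → E p) | ∃ acc, z.1 = Move.exchange i acc} 1
        (Move.exchange k true, x ∘ Equiv.swap k (next k)) +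
      ENNReal.ofReal (1 - A.exchangeProb t x k) *
      Set.indicator {z : Move L × (Fin L → E p) | ∃ acc, z.1 = Move.exchange i acc} 1
        (Move.exchange k false, x)) = 0 := fun k => by
    rcases eq_or_ne k i with rfl | hk
    · simp [h0]
    · simp [hk]
  rw [Finset.sum_congr rfl fun k _ => hs k]
  simp

theorem Spec.chainKernel_real_compl_support {p L : ℕ} {A : Spec p L} (hA : A.Regular) {N : ℕ}
    {θ : (Fin L → Fin p → ℝ) × (Fin L → ℝ)} (hθ : θ ∈ A.params) {x : Fin L → E p}
    (hx : ∀ l, x l ∈ A.S) : (A.chainKernel N θ x).real (Set.univ.pi fun _ => A.S)ᶜ = 0 := by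
  have hp := isProbabilityMeasure_levelKernel hA N hθ
  have hS := measurableSet_support hA
  have hl : ∀ l, A.levelKernel N θ l (x l) A.Sᶜ = 0 := fun l => by
    unfold levelKernel
    split_ifs
    · rw [densityKernel_apply _ hS.compl]
      have : ∀ y, A.moveDensity (θ.1 l) (θ.2 l) (x l) y * A.Sᶜ.indicator 1 y = 0 := fun y => by
        by_cases hy : y ∈ A.S
        · simp [hy]
        · rw [moveDensity_of_notMem _ _ (by tauto), zero_mul]
      simp [this, hx l]
    · simp [Measure.dirac_apply' _ hS.compl, hx l]
  have hpi : (Measure.pi fun l => A.levelKernel N θ l (x l)) (Set.univ.pi fun _ => A.S)ᶜ = 0 := by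
    rw [prob_compl_eq_zero_iff (.univ_pi fun _ => hS), Measure.pi_pi]
    exact Finset.prod_eq_one fun l _ => (prob_compl_eq_zero_iff hS).1 (hl l)
  rw [measureReal_def, chainKernel, temperingKernel_apply _ (MeasurableSet.univ_pi
    fun _ => hS).compl, hpi]
  have h1 : ∀ σ : Equiv.Perm (Fin L),
      (Set.univ.pi fun _ => A.S)ᶜ.indicator (1 : (Fin L → E p) → ENNReal) (x ∘ σ) = 0 := fun σ =>
    Set.indicator_of_notMem (not_not.2 fun l _ => hx _) _
  have h2 : (Set.univ.pi fun _ => A.S)ᶜ.indicator (1 : (Fin L → E p) → ENNReal) x = 0 := h1 1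
  simp [h1, h2]

/-! ### Almost sure invariants of a run -/

namespace Run

variable {p L : ℕ} {Ω : Type*} [MeasurableSpace Ω] {A : Spec p L} {P : Measure Ω}
  {ℱ : Filtration ℕ (inferInstance : MeasurableSpace Ω)} {R : Run p L Ω}
  {x₀ : Fin L → E p} {ζ₀ : Fin L → ℝ} {γ₀ μ₀ : Fin L → Fin p → ℝ}

/-- The parameters of the kernel used at time `n`. -/
noncomputable def par (R : Run p L Ω) (n : ℕ) (ω : Ω) : (Fin L → Fin p → ℝ) × (Fin L → ℝ) :=
  (R.γ n ω, R.temp n ω)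

theorem measurable_step (hR : R.IsAdaptivePT A P ℱ x₀ ζ₀ γ₀ μ₀) (n : ℕ) :
    Measurable fun ω => (R.move n ω, R.X (n + 1) ω) :=
  ((hR.move_meas n).mono (ℱ.le _) le_rfl).prodMk ((hR.X_meas (n + 1)).mono (ℱ.le _) le_rfl)

/-- The conditional law of the iteration, integrated over an event of the past. -/
theorem real_inter_step [IsProbabilityMeasure P] (hR : R.IsAdaptivePT A P ℱ x₀ ζ₀ γ₀ μ₀) (n : ℕ) {s : Set Ω}
    (hs : MeasurableSet[ℱ n] s) {B : Set (Move L × (Fin L → E p))} (hB : MeasurableSet B) :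
    P.real (s ∩ (fun ω => (R.move n ω, R.X (n + 1) ω)) ⁻¹' B) =
      ∫ ω in s, (A.stepLaw (R.N n ω) (R.γ n ω) (R.temp n ω) (R.X n ω)).real B ∂P := by
  have hm := measurable_step hR n hB
  rw [← setIntegral_congr_ae (g := fun ω => (A.stepLaw (R.N n ω) (R.γ n ω) (R.temp n ω)
    (R.X n ω)).real B) (ℱ.le n _ hs) ((hR.step n B hB).mono fun ω h _ => h),
    setIntegral_condExp (ℱ.le n) ((integrable_const _).indicator hm) hs,
    setIntegral_indicator hm]
  simp

/-- Inherited from the conditional expectation, so joint measurability of `stepLaw` in positions and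
parameters is not needed. -/
theorem integrable_stepLaw (hR : R.IsAdaptivePT A P ℱ x₀ ζ₀ γ₀ μ₀) (n : ℕ)
    {B : Set (Move L × (Fin L → E p))} (hB : MeasurableSet B) :
    Integrable (fun ω => (A.stepLaw (R.N n ω) (R.γ n ω) (R.temp n ω) (R.X n ω)).real B) P :=
  (integrable_condExp).congr (hR.step n B hB)

theorem ae_step_notMem [IsProbabilityMeasure P] (hR : R.IsAdaptivePT A P ℱ x₀ ζ₀ γ₀ μ₀) (n : ℕ) {s : Set Ω}
    (hs : MeasurableSet[ℱ n] s) {B : Set (Move L × (Fin L → E p))} (hB : MeasurableSet B)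
    (h : ∀ᵐ ω ∂P, ω ∈ s → (A.stepLaw (R.N n ω) (R.γ n ω) (R.temp n ω) (R.X n ω)).real B = 0) :
    ∀ᵐ ω ∂P, ω ∈ s → (R.move n ω, R.X (n + 1) ω) ∉ B := by
  have h1 := real_inter_step hR n hs hB
  rw [setIntegral_congr_ae (g := fun _ => (0 : ℝ)) (ℱ.le n _ hs) h, integral_zero,
    measureReal_eq_zero_iff] at h1
  filter_upwards [measure_eq_zero_iff_ae_notMem.1 h1] with ω hω hωs hωB using hω ⟨hωs, hωB⟩

theorem ae_N (hR : R.IsAdaptivePT A P ℱ x₀ ζ₀ γ₀ μ₀) (hL : 1 ≤ L) :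
    ∀ᵐ ω ∂P, Antitone (fun n => R.N n ω) ∧ ∀ n, 1 ≤ R.N n ω ∧ R.N n ω ≤ L := by
  have h1 : ∀ n, ∀ᵐ ω ∂P, R.N (n + 1) ω = R.N n ω ∨
      R.N (n + 1) ω = newCount A.d (R.N n ω) (R.cnt (n + 1) ω) := fun n => by
    by_cases h : 0 < n ∧ A.m ∣ n
    · exact (hR.N_check n h.1 h.2).mono fun ω h => Or.inr h
    · exact (hR.N_other n h).mono fun ω h => Or.inl h
  filter_upwards [ae_all_iff.2 h1, hR.init] with ω hω hinit
  have hle : ∀ n, R.N (n + 1) ω ≤ R.N n ω := fun n => by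
    rcases hω n with h | h
    · exact h.le
    · exact h ▸ newCount_le _ _ _
  refine ⟨antitone_nat_of_succ_le hle, fun n => ?_⟩
  induction n with
  | zero => rw [hinit.2.2.2.2.2]; exact ⟨hL, le_rfl⟩
  | succ n ih =>
    refine ⟨?_, (hle n).trans ih.2⟩
    rcases hω n with h | h
    · exact h ▸ ih.1
    · exact h ▸ one_le_newCount ih.1

theorem ae_exchange [IsProbabilityMeasure P] (hA : A.Regular) (hR : R.IsAdaptivePT A P ℱ x₀ ζ₀ γ₀ μ₀) :
    ∀ᵐ ω ∂P, ∀ n i acc, R.move n ω = Move.exchange i acc → i.val + 1 < R.N n ω := by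
  refine ae_all_iff.2 fun n => ae_all_iff.2 fun i => ?_
  have hs : MeasurableSet[ℱ n] {ω | R.N n ω ≤ i.val + 1} := hR.N_meas n measurableSet_Iic
  have hB : MeasurableSet {z : Move L × (Fin L → E p) | ∃ acc, z.1 = Move.exchange i acc} :=
    measurable_fst (t := {a : Move L | ∃ acc, a = Move.exchange i acc}) trivial
  filter_upwards [ae_step_notMem hR n hs hB (ae_of_all _ fun ω hω =>
    Spec.stepLaw_real_exchange_eq_zero hA hω _ _ _)] with ω hω acc hacc
  by_contra h
  exact hω (not_lt.1 h) ⟨acc, hacc⟩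

theorem ae_par_mem [IsProbabilityMeasure P] [NeZero L] (hA : A.Regular) (hR : R.IsAdaptivePT A P ℱ x₀ ζ₀ γ₀ μ₀)
    (hζ₀ : ζ₀ 0 = 0) (hζ₀' : ∀ l, l ≠ 0 → Real.exp (ζ₀ l) ∈ A.T)
    (hγ₀ : ∀ l, γ₀ l ∈ A.varBox) :
    ∀ᵐ ω ∂P, ∀ n, R.par n ω ∈ A.params ∧ R.temp n ω 0 = 1 := by
  filter_upwards [ae_N hR NeZero.one_le, ae_exchange hA hR, hR.init, ae_all_iff.2 hR.ζ_exchange,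
    ae_all_iff.2 hR.ζ_other, ae_all_iff.2 hR.γ_parallel, ae_all_iff.2 hR.γ_other]
    with ω hN hex hinit hζ hζ' hγ hγ'
  have h1 : ∀ n l, R.γ n ω l ∈ A.varBox := fun n => by
    induction n with
    | zero => rw [hinit.2.2.1]; exact hγ₀
    | succ n ih =>
      intro l
      by_cases h : R.move n ω = Move.parallel ∧ l.val < R.N n ω
      · exact fun j _ => (hγ n h.1 l h.2 j).1
      · rw [hγ' n l h]; exact ih l
  have h2 : ∀ n, R.ζ n ω 0 = 0 ∧ ∀ l, l ≠ 0 → Real.exp (R.ζ n ω l) ∈ A.T := fun n => by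
    induction n with
    | zero => rw [hinit.2.1]; exact ⟨hζ₀, hζ₀'⟩
    | succ n ih =>
      by_cases h : ∃ i acc, R.move n ω = Move.exchange i acc
      · obtain ⟨i, acc, h⟩ := h
        obtain ⟨hr, hk⟩ := hζ n i acc h
        -- A chosen pair satisfies `i + 1 < N ≤ L`, so its upper level is not level `0`, whose
        -- temperature therefore never changes.
        have hne : (0 : Fin L) ≠ next i := fun h0 => by
          have := congrArg Fin.val h0
          rw [val_next ((hex n i acc h).trans_le (hN.2 n).2)] at this
          simp at this
        refine ⟨(hk 0 hne).trans ih.1, fun l hl => ?_⟩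
        rcases eq_or_ne l (next i) with rfl | hln
        · exact hr.1
        · rw [hk l hln]; exact ih.2 l hl
      · rw [hζ' n fun i acc h' => h ⟨i, acc, h'⟩]
        exact ih
  refine fun n => ⟨fun l => ⟨h1 n l, ?_⟩, ?_⟩
  · rcases eq_or_ne l 0 with rfl | hl
    · left; simp [par, temp, (h2 n).1]
    · right; exact (h2 n).2 l hl
  · simp [temp, (h2 n).1]

/-- By induction on time, because `stepLaw` is identified with `chainKernel` only from positions in
`S`. -/
theorem ae_X_mem [IsProbabilityMeasure P] [NeZero L] (hA : A.Regular) (hR : R.IsAdaptivePT A P ℱ x₀ ζ₀ γ₀ μ₀)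
    (hx₀ : ∀ l, x₀ l ∈ A.S) (hpar : ∀ᵐ ω ∂P, ∀ n, R.par n ω ∈ A.params ∧ R.temp n ω 0 = 1) :
    ∀ᵐ ω ∂P, ∀ n l, R.X n ω l ∈ A.S := by
  refine ae_all_iff.2 fun n => ?_
  induction n with
  | zero =>
    filter_upwards [hR.init] with ω h
    rw [h.1]; exact hx₀
  | succ n ih =>
    have hB : MeasurableSet (Set.univ.pi fun _ : Fin L => A.S)ᶜ :=
      (MeasurableSet.univ_pi fun _ => Spec.measurableSet_support hA).compl
    have h := ae_step_notMem hR n (s := Set.univ) MeasurableSet.univ (measurable_snd hB) (by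
      filter_upwards [ih, hpar] with ω hX hp _
      exact (Spec.stepLaw_real_snd hA (R.N n ω) (hp n).1 hX hB).trans
        (Spec.chainKernel_real_compl_support hA (hp n).1 hX))
    filter_upwards [h] with ω hω l
    by_contra hl
    exact hω trivial fun h => hl (h l trivial)

end Run

/-! ### Diminishing adaptation -/

namespace Run

variable {p L : ℕ} {Ω : Type*} [MeasurableSpace Ω] {A : Spec p L} {P : Measure Ω}
  {ℱ : Filtration ℕ (inferInstance : MeasurableSpace Ω)} {R : Run p L Ω}
  {x₀ : Fin L → E p} {ζ₀ : Fin L → ℝ} {γ₀ μ₀ : Fin L → Fin p → ℝ}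

/-- In each case the mean is averaged with the new position, with weight `b_n`, `1` or `0`; this is
the form that `exists_eventually_abs_le` bounds. -/
theorem ae_μ_cases (hR : R.IsAdaptivePT A P ℱ x₀ ζ₀ γ₀ μ₀) :
    ∀ᵐ ω ∂P, ∀ n l j,
      R.μ (n + 1) ω l j = R.μ n ω l j + A.b n * (R.X (n + 1) ω l j - R.μ n ω l j) ∨
      R.μ (n + 1) ω l j = R.X (n + 1) ω l j ∨ R.μ (n + 1) ω l j = R.μ n ω l j := by
  filter_upwards [ae_all_iff.2 hR.μ_parallel, ae_all_iff.2 hR.μ_exchange, ae_all_iff.2 hR.μ_other]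
    with ω h1 h2 h3 n l j
  by_cases hp : R.move n ω = Move.parallel ∧ l.val < R.N n ω
  · exact Or.inl (h1 n hp.1 l hp.2 j)
  by_cases he : ∃ i, R.move n ω = Move.exchange i true ∧ (l = i ∨ l = next i)
  · obtain ⟨i, hi, hl⟩ := he
    exact Or.inr (Or.inl (h2 n i hi l hl j))
  · push Not at he
    exact Or.inr (Or.inr (congrFun (h3 n l hp he) j))

/-- An average recursion with weights tending to zero stays bounded. -/
theorem exists_eventually_abs_le {u x b : ℕ → ℝ} {C : ℝ} (hb0 : ∀ n, 0 ≤ b n)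
    (hb : Tendsto b atTop (𝓝 0)) (hx : ∀ n, |x n| ≤ C)
    (h : ∀ n, u (n + 1) = u n + b n * (x n - u n) ∨ u (n + 1) = x n ∨ u (n + 1) = u n) :
    ∃ M, ∀ᶠ n in atTop, |u n| ≤ M := by
  -- Once `b n ≤ 1`, every update is a convex combination and cannot leave the interval reached at
  -- time `n₀`, enlarged to contain all `x n`.
  obtain ⟨n₀, hn₀⟩ := eventually_atTop.1 (hb.eventually_le_const one_pos)
  refine ⟨max |u n₀| C, eventually_atTop.2 ⟨n₀, fun n hn => ?_⟩⟩
  induction n, hn using Nat.le_induction with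
  | base => exact le_max_left _ _
  | succ n hn ih =>
    have hxn : |x n| ≤ max |u n₀| C := (hx n).trans (le_max_right _ _)
    rcases h n with h | h | h
    · have e : u (n + 1) = (1 - b n) * u n + b n * x n := by rw [h]; ring
      have h1 : 0 ≤ 1 - b n := by linarith [hn₀ n hn]
      rw [e]
      calc |(1 - b n) * u n + b n * x n| ≤ (1 - b n) * |u n| + b n * |x n| := by
            refine (abs_add_le _ _).trans ?_
            rw [abs_mul, abs_mul, abs_of_nonneg h1, abs_of_nonneg (hb0 n)]
        _ ≤ (1 - b n) * max |u n₀| C + b n * max |u n₀| C :=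
            add_le_add (mul_le_mul_of_nonneg_left ih h1) (mul_le_mul_of_nonneg_left hxn (hb0 n))
        _ = max |u n₀| C := by ring
    · rw [h]; exact hxn
    · rw [h]; exact ih

/-- Diminishing adaptation. -/
theorem ae_tendsto_par (hA : A.Regular) (hR : R.IsAdaptivePT A P ℱ x₀ ζ₀ γ₀ μ₀)
    (hpar : ∀ᵐ ω ∂P, ∀ n, R.par n ω ∈ A.params) (hX : ∀ᵐ ω ∂P, ∀ n l, R.X n ω l ∈ A.S) :
    ∀ᵐ ω ∂P, Tendsto (fun n => R.par (n + 1) ω - R.par n ω) atTop (𝓝 0) := by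
  obtain ⟨D, hD⟩ := hA.compact.isBounded.exists_norm_le
  obtain ⟨T, hT⟩ := Spec.exists_temps_subset hA
  filter_upwards [ae_μ_cases hR, ae_all_iff.2 hR.ζ_exchange, ae_all_iff.2 hR.ζ_other,
    ae_all_iff.2 hR.γ_parallel, ae_all_iff.2 hR.γ_other, hR.a_tendsto, hpar, hX]
    with ω hμ hζ hζ' hγ hγ' ha hpar hX
  have hXD : ∀ n l j, |R.X n ω l j| ≤ D := fun n l j =>
    (PiLp.norm_apply_le (R.X n ω l) j).trans (hD _ (hX n l))
  have hγt : ∀ l j, Tendsto (fun n => R.γ (n + 1) ω l j - R.γ n ω l j) atTop (𝓝 0) := fun l j => by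
    -- The bound `M` depends on the path, which suffices for an almost sure limit.
    obtain ⟨M, hM⟩ := exists_eventually_abs_le (u := fun n => R.μ n ω l j)
      (x := fun n => R.X (n + 1) ω l j) hA.b_nonneg hA.b_tendsto (fun n => hXD _ l j)
      fun n => hμ n l j
    have hlim : Tendsto (fun n => A.b n * ((D + M) ^ 2 + max |A.c| |A.C|)) atTop (𝓝 0) := by
      simpa using hA.b_tendsto.mul_const ((D + M) ^ 2 + max |A.c| |A.C|)
    refine squeeze_zero_norm' ?_ hlim
    filter_upwards [(tendsto_add_atTop_nat 1).eventually hM] with n hn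
    have hγn : |R.γ n ω l j| ≤ max |A.c| |A.C| := by
      have := (hpar n l).1 j trivial
      exact abs_le_max_abs_abs this.1 this.2
    rw [Real.norm_eq_abs]
    by_cases h : R.move n ω = Move.parallel ∧ l.val < R.N n ω
    · refine (hγ n h.1 l h.2 j).2.2.trans ?_
      rw [add_sub_cancel_left, abs_mul, abs_of_nonneg (hA.b_nonneg n)]
      refine mul_le_mul_of_nonneg_left ((abs_sub _ _).trans (add_le_add ?_ hγn)) (hA.b_nonneg n)
      rw [abs_pow]
      exact pow_le_pow_left₀ (abs_nonneg _) ((abs_sub _ _).trans (add_le_add (hXD _ l j) hn)) 2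
    · rw [hγ' n l h, sub_self, abs_zero]
      exact mul_nonneg (hA.b_nonneg n) (add_nonneg (sq_nonneg _)
        ((abs_nonneg _).trans (le_max_left _ _)))
  have htt : ∀ l, Tendsto (fun n => R.temp (n + 1) ω l - R.temp n ω l) atTop (𝓝 0) := fun l => by
    have hlim : Tendsto (fun n => T * |R.a n ω l|) atTop (𝓝 0) := by
      simpa using (ha l).abs.const_mul T
    refine squeeze_zero_norm (fun n => ?_) hlim
    have hle : ∀ n, Real.exp (R.ζ n ω l) ≤ T := fun n => (hT (hpar n l).2).2
    have hT0 : 0 ≤ T := (Real.exp_pos _).le.trans (hle 0)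
    refine (abs_exp_sub_exp_le (hle _) (hle _)).trans (mul_le_mul_of_nonneg_left ?_ hT0)
    by_cases h : ∃ i acc, R.move n ω = Move.exchange i acc
    · obtain ⟨i, acc, h⟩ := h
      obtain ⟨hr, hk⟩ := hζ n i acc h
      rcases eq_or_ne l (next i) with rfl | hln
      · refine hr.2.2.trans ?_
        rw [sub_right_comm, sub_self, zero_sub, abs_neg, abs_mul]
        -- The difference `ER - α` lies in `[-1, 1]`.
        refine mul_le_of_le_one_right (abs_nonneg _) ?_
        have := hA.α_mem
        rw [abs_le]
        split_ifs <;> constructor <;> linarith [this.1, this.2]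
      · rw [hk l hln, sub_self, abs_zero]; exact abs_nonneg _
    · rw [hζ' n fun i acc h' => h ⟨i, acc, h'⟩, sub_self, abs_zero]; exact abs_nonneg _
  exact (tendsto_pi_nhds.2 fun l => tendsto_pi_nhds.2 fun j => hγt l j).prodMk_nhds
    (tendsto_pi_nhds.2 htt)

theorem tendsto_dist_add {X : Type*} [SeminormedAddCommGroup X] {u : ℕ → X}
    (h : Tendsto (fun n => u (n + 1) - u n) atTop (𝓝 0)) (k : ℕ) :
    Tendsto (fun n => dist (u (n + k)) (u n)) atTop (𝓝 0) := by
  simp only [dist_eq_norm]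
  refine (tendsto_zero_iff_norm_tendsto_zero (f := fun n => u (n + k) - u n)).1 ?_
  induction k with
  | zero => simpa using tendsto_const_nhds
  | succ k ih =>
    have := ((tendsto_add_atTop_iff_nat k).2 h).add ih
    simp only [add_zero] at this
    refine this.congr fun n => ?_
    rw [sub_add_sub_cancel, add_assoc]

/-- The event that the parameters move by `δ` or more within `K` steps from time `n`, or that the
number of levels changes. -/
def drift (R : Run p L Ω) (K : ℕ) (δ : ℝ) (n : ℕ) : Set Ω :=
  {ω | ∃ k < K, δ ≤ dist (R.par (n + k) ω) (R.par n ω) ∨ R.N (n + k) ω ≠ R.N n ω}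

theorem measurable_par (hR : R.IsAdaptivePT A P ℱ x₀ ζ₀ γ₀ μ₀) (n : ℕ) :
    Measurable[ℱ n] (R.par n) := by
  refine Measurable.prodMk (hR.γ_meas n) ?_
  exact @measurable_pi_lambda _ _ _ (ℱ n) _ _ fun l =>
    Real.measurable_exp.comp ((measurable_pi_apply l).comp (hR.ζ_meas n))

theorem measurableSet_drift (hR : R.IsAdaptivePT A P ℱ x₀ ζ₀ γ₀ μ₀) (K : ℕ) (δ : ℝ) (n : ℕ) :
    MeasurableSet (R.drift K δ n) := by
  have hp := fun n => (measurable_par hR n).mono (ℱ.le n) le_rfl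
  have hN := fun n => (hR.N_meas n).mono (ℱ.le n) le_rfl
  have : R.drift K δ n = ⋃ k < K, ({ω | δ ≤ dist (R.par (n + k) ω) (R.par n ω)} ∪
      {ω | R.N (n + k) ω = R.N n ω}ᶜ) := by
    ext ω; simp [drift]
  rw [this]
  exact .iUnion fun k => .iUnion fun _ =>
    (measurableSet_le measurable_const ((hp _).dist (hp n))).union
      (measurableSet_eq_fun (hN _) (hN n)).compl

theorem tendsto_real_drift [IsProbabilityMeasure P] (hR : R.IsAdaptivePT A P ℱ x₀ ζ₀ γ₀ μ₀)
    (hL : 1 ≤ L) (h : ∀ᵐ ω ∂P, Tendsto (fun n => R.par (n + 1) ω - R.par n ω) atTop (𝓝 0)) (K : ℕ)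
    {δ : ℝ} (hδ : 0 < δ) : Tendsto (fun n => P.real (R.drift K δ n)) atTop (𝓝 0) := by
  -- Almost every path eventually lies outside of the drift events, so their indicators tend to
  -- zero, and the probabilities follow since `P` is finite.
  have key : Tendsto (fun n => P (R.drift K δ n)) atTop (𝓝 (P ∅)) := by
    refine tendsto_measure_of_ae_tendsto_indicator_of_isFiniteMeasure atTop .empty
      (measurableSet_drift hR K δ) ?_
    filter_upwards [h, ae_N hR hL] with ω hω hN
    have h1 : ∀ᶠ n in atTop, ∀ k < K, dist (R.par (n + k) ω) (R.par n ω) < δ :=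
      (eventually_all_finite (Set.finite_lt_nat K)).2 fun k _ =>
        (tendsto_dist_add (u := fun n => R.par n ω) hω k).eventually_lt_const hδ
    have h2 : ∃ c, ∀ᶠ n in atTop, R.N n ω = c := by
      have := tendsto_atTop_ciInf hN.1 (OrderBot.bddBelow _)
      rw [nhds_discrete] at this
      exact ⟨_, tendsto_pure.1 this⟩
    obtain ⟨c, hc⟩ := h2
    obtain ⟨n₀, hn₀⟩ := eventually_atTop.1 hc
    filter_upwards [h1, eventually_ge_atTop n₀] with n hn hnn
    refine iff_of_false ?_ (Set.notMem_empty ω)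
    rintro ⟨k, hk, h | h⟩
    · exact absurd (hn k hk) (not_lt.2 h)
    · exact h ((hn₀ _ (by lia)).trans (hn₀ _ hnn).symm)
  have := (ENNReal.tendsto_toReal (by simp)).comp key
  rw [measure_empty, ENNReal.toReal_zero] at this
  exact this

end Run

/-! ### Convergence of the law of level `0` -/

namespace Run

variable {p L : ℕ} [NeZero L] {Ω : Type*} [MeasurableSpace Ω] {A : Spec p L} {P : Measure Ω}
  [IsProbabilityMeasure P] {ℱ : Filtration ℕ (inferInstance : MeasurableSpace Ω)} {R : Run p L Ω}
  {x₀ : Fin L → E p} {ζ₀ : Fin L → ℝ} {γ₀ μ₀ : Fin L → Fin p → ℝ}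

/-- On an event of the past on which the kernels of the next `K` steps stay close to that of the
parameters `θ`, the law of level `0` after `K` steps is close to the target. -/
theorem abs_real_inter_sub_target_le (hA : A.Regular) (hR : R.IsAdaptivePT A P ℱ x₀ ζ₀ γ₀ μ₀)
    (hpar : ∀ᵐ ω ∂P, ∀ n, R.par n ω ∈ A.params) (hX : ∀ᵐ ω ∂P, ∀ n l, R.X n ω l ∈ A.S)
    {β : ℝ} (hβ0 : 0 ≤ β) (hβ1 : β ≤ 1) {N : ℕ} (hN : 1 ≤ N) (hNL : N ≤ L)
    {θ : (Fin L → Fin p → ℝ) × (Fin L → ℝ)} (hθ : θ ∈ A.params) (hθ1 : θ.2 0 = 1)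
    {z : E p} (hz : z ∈ A.S)
    (hm : ∃ m : Measure (Fin L → E p), IsFiniteMeasure m ∧ β ≤ m.real Set.univ ∧
      ∀ x ∈ {x : Fin L → E p | (∀ l, x l ∈ A.S) ∧ ∀ l : Fin L, N ≤ l.val → x l = z},
        m ≤ A.chainKernel N θ x)
    {n K : ℕ} {s : Set Ω} (hs : MeasurableSet[ℱ n] s) {D : Set Ω} (hD : MeasurableSet D)
    {ε : ℝ} (hε : 0 ≤ ε)
    (hclose : ∀ ω ∈ s, ω ∉ D → ∀ k < K, R.N (n + k) ω = N ∧ (R.par (n + k) ω ∈ A.params →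
      ∀ x : Fin L → E p, (∀ l, x l ∈ A.S) → ∀ B, MeasurableSet B →
        |(A.chainKernel N (R.par (n + k) ω) x).real B - (A.chainKernel N θ x).real B| ≤ ε))
    {B : Set (E p)} (hB : MeasurableSet B) :
    |P.real (s ∩ (fun ω => R.X (n + K) ω 0) ⁻¹' B) - P.real s * A.target.real B| ≤
      (1 - β) ^ K * P.real s + K * (ε * P.real s + P.real (s ∩ D)) := by
  obtain ⟨m, hmf, hmβ, hm⟩ := hm
  have hlm : ∀ l, θ.2 l ∈ A.temps := fun l => (hθ l).2
  have hker := Spec.isProbabilityMeasure_chainKernel hA hNL hθ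
  have htar := Spec.isProbabilityMeasure_chainTarget hA N z hlm
  have hXm : ∀ k, Measurable (R.X k) := fun k => (hR.X_meas k).mono (ℱ.le k) le_rfl
  have hfm := measurable_freeze (L := L) N z
  have hs' : MeasurableSet s := ℱ.le n s hs
  have hpos : ∀ l : Fin L, l = 0 → l.val < N := fun l hl => by
    rw [hl, Fin.val_zero]; exact hN
  -- Since `D` need not belong to the past, it stays inside the integral: outside of `D` the kernels
  -- differ by at most `ε`, on `D` by at most `1`.
  have hstep : ∀ k < K, ∀ C, MeasurableSet C →
      |P.real (s ∩ (fun ω => freeze N z (R.X (n + (k + 1)) ω)) ⁻¹' C) -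
        ∫ ω in s, (A.chainKernel N θ (freeze N z (R.X (n + k) ω))).real C ∂P| ≤
          ε * P.real s + P.real (s ∩ D) := by
    intro k hk C hC
    have hC' : MeasurableSet (Prod.snd ⁻¹' (freeze N z ⁻¹' C) : Set (Move L × (Fin L → E p))) :=
      measurable_snd (hfm hC)
    have h1 := real_inter_step hR (n + k) (ℱ.mono (Nat.le_add_right n k) _ hs) hC'
    have h2 : (fun ω => (R.move (n + k) ω, R.X (n + k + 1) ω)) ⁻¹'
        (Prod.snd ⁻¹' (freeze N z ⁻¹' C)) =
        (fun ω => freeze N z (R.X (n + (k + 1)) ω)) ⁻¹' C := rfl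
    have hint1 := integrable_stepLaw hR (n + k) hC'
    have hcm : Measurable fun ω => (A.chainKernel N θ (freeze N z (R.X (n + k) ω))).real C :=
      (((Measure.measurable_coe hC).comp (Spec.measurable_chainKernel hA N hθ)).comp
        (hfm.comp (hXm _))).ennreal_toReal
    have hint2 : Integrable
        (fun ω => (A.chainKernel N θ (freeze N z (R.X (n + k) ω))).real C) P :=
      Integrable.of_bound hcm.aestronglyMeasurable 1 (ae_of_all _ fun ω => by
        rw [Real.norm_of_nonneg measureReal_nonneg]; exact measureReal_le_one)
    have hintD : Integrable (fun ω => ε + D.indicator (fun _ => (1 : ℝ)) ω) (P.restrict s) :=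
      (integrable_const _).add ((integrable_const _).indicator hD)
    rw [← h2, h1, ← integral_sub hint1.integrableOn hint2.integrableOn, ← Real.norm_eq_abs]
    refine (norm_integral_le_of_norm_le hintD ?_).trans_eq ?_
    · rw [ae_restrict_iff' hs']
      filter_upwards [hpar, hX, ae_N hR NeZero.one_le] with ω hp hx hNn hωs
      rw [Real.norm_eq_abs]
      have e1 := Spec.stepLaw_real_snd hA (R.N (n + k) ω) (hp (n + k)) (hx (n + k)) (hfm hC)
      change (A.stepLaw _ (R.γ (n + k) ω) (R.temp (n + k) ω) _).real _ = _ at e1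
      rw [e1]
      by_cases hωD : ω ∈ D
      · have := Spec.isProbabilityMeasure_chainKernel hA (hNn.2 (n + k)).2 (hp (n + k))
          (R.X (n + k) ω)
        rw [Set.indicator_of_mem hωD]
        refine (abs_sub_le_of_nonneg_of_le measureReal_nonneg measureReal_le_one
          measureReal_nonneg measureReal_le_one).trans (by linarith)
      · obtain ⟨hNk, hc⟩ := hclose ω hωs hωD k hk
        -- Freezing is shifted from the starting point to the set, so that both kernels start at the
        -- same position.
        rw [Set.indicator_of_notMem hωD, add_zero, hNk, ← Spec.chainKernel_freeze hA hNL hθ z _ hC]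
        exact hc (hp _) _ (hx _) _ (hfm hC)
    · rw [integral_add (integrable_const _) ((integrable_const _).indicator hD), integral_const,
        setIntegral_indicator hD]
      simp [mul_comm]
  have hmain := abs_real_inter_sub_le (P := P)
    (X := fun k ω => freeze N z (R.X (n + k) ω)) (fun k => hfm.comp (hXm _)) (A := s)
    (Spec.measurable_chainKernel hA N hθ) (Spec.chainTarget_bind hA hNL hθ z) hβ0 hβ1 hmβ hm
    (fun k => hX.mono fun ω h => ⟨fun l => by
        unfold freeze; split_ifs; exacts [h _ _, hz], fun l hl => if_neg (by lia)⟩)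
    (Spec.ae_mem_chainTarget hA N hz hlm) hstep
    (measurable_pi_apply (0 : Fin L) hB)
  rw [Spec.chainTarget_real_eval hA z hlm (hpos 0 rfl) hθ1 hB] at hmain
  have e : (fun ω => freeze N z (R.X (n + K) ω)) ⁻¹' ((fun x : Fin L → E p => x 0) ⁻¹' B) =
      (fun ω => R.X (n + K) ω 0) ⁻¹' B := by
    ext ω; simp only [Set.mem_preimage, freeze, if_pos (hpos 0 rfl)]
  rw [← e]
  exact hmain

/-- The law of level `0` converges to the target, uniformly over the measurable sets. -/
theorem eventually_abs_real_sub_target_le (hA : A.Regular)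
    (hR : R.IsAdaptivePT A P ℱ x₀ ζ₀ γ₀ μ₀) (hx₀ : ∀ l, x₀ l ∈ A.S)
    (hζ₀ : ζ₀ 0 = 0) (hζ₀' : ∀ l, l ≠ 0 → Real.exp (ζ₀ l) ∈ A.T)
    (hγ₀ : ∀ l, γ₀ l ∈ A.varBox) {ε : ℝ} (hε : 0 < ε) :
    ∀ᶠ n in atTop, ∀ B, MeasurableSet B →
      |P.real ((fun ω => R.X n ω 0) ⁻¹' B) - A.target.real B| ≤ ε := by
  have hpar := ae_par_mem hA hR hζ₀ hζ₀' hγ₀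
  have hX := ae_X_mem hA hR hx₀ hpar
  have hpar' : ∀ᵐ ω ∂P, ∀ n, R.par n ω ∈ A.params := hpar.mono fun ω h n => (h n).1
  obtain ⟨β, hβ0, hβ1, hβ⟩ := Spec.exists_minorization hA
  -- The order of choices: `K` from the contraction rate, then `δ` from `K`, then `n₀` from both.
  -- Contraction, freezing of the parameters and drift each cost `ε / 3`.
  obtain ⟨K, hK⟩ := exists_pow_lt_of_lt_one (show 0 < ε / 3 by positivity)
    (show 1 - β < 1 by linarith)
  obtain ⟨δ, hδ, hclose⟩ := Spec.exists_uniform_chainKernel hA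
    (show 0 < ε / 3 / (K + 1) by positivity)
  set ε' := ε / 3 / (K + 1) with hε'
  have hKε' : K * ε' ≤ ε / 3 := by
    rw [hε', mul_div_assoc', div_le_iff₀ (by positivity)]
    nlinarith
  obtain ⟨T, hT⟩ := Spec.exists_temps_subset hA
  have hcomp : IsCompact ((Set.univ.pi fun _ : Fin L => A.varBox) ×ˢ
      (Set.univ.pi fun _ : Fin L => Set.Icc (0 : ℝ) T)) :=
    (isCompact_univ_pi fun _ => isCompact_univ_pi fun _ => isCompact_Icc).prod
      (isCompact_univ_pi fun _ => isCompact_Icc)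
  -- The parameter set need not be closed, but total boundedness suffices. The net is chosen inside
  -- the set, so that the invariant law of each net point has the target as its marginal at level
  -- `0`.
  have htb : TotallyBounded {θ ∈ A.params | θ.2 0 = 1} := by
    refine hcomp.totallyBounded.subset ?_
    rintro θ ⟨hθ, -⟩
    exact ⟨fun l _ => (hθ l).1, fun l _ => hT (hθ l).2⟩
  obtain ⟨t, hts, htf, ht⟩ := Metric.finite_approx_of_totallyBounded htb (δ / 2) (by positivity)
  have hdrift := (tendsto_real_drift hR NeZero.one_le (ae_tendsto_par hA hR hpar' hX) K
    (show 0 < δ / 2 by positivity)).const_mul (K : ℝ)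
  rw [mul_zero] at hdrift
  have hev := hdrift.eventually_lt_const (show 0 < ε / 3 by positivity)
  obtain ⟨n₀, hn₀⟩ := eventually_atTop.1 hev
  refine eventually_atTop.2 ⟨n₀ + K, fun k hk B hB => ?_⟩
  obtain ⟨n, rfl⟩ : ∃ n, k = n + K := ⟨k - K, by lia⟩
  have hn : n₀ ≤ n := by lia
  set D := R.drift K (δ / 2) n with hD
  have hDm : MeasurableSet D := measurableSet_drift hR K (δ / 2) n
  set U : (((Fin L → Fin p → ℝ) × (Fin L → ℝ)) × ℕ) → Set Ω := fun i =>
    {ω | dist (R.par n ω) i.1 < δ / 2 ∧ R.N n ω = i.2} with hU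
  have hUm : ∀ i, MeasurableSet[ℱ n] (U i) := fun i =>
    (measurable_par hR n Metric.isOpen_ball.measurableSet).inter
      (hR.N_meas n (measurableSet_singleton i.2))
  have hfin : (t ×ˢ Set.Icc 1 L).Finite := htf.prod (Set.finite_Icc 1 L)
  -- The cells `U i` may overlap, so `s` is split into `s ∩ U i` and `s \ U i`, one cell at a time.
  -- The right-hand side is additive in `s`, hence independent of the number of cells.
  have key : ∀ I : Set (((Fin L → Fin p → ℝ) × (Fin L → ℝ)) × ℕ), I.Finite →
      I ⊆ t ×ˢ Set.Icc 1 L → ∀ s, MeasurableSet[ℱ n] s → s ⊆ ⋃ i ∈ I, U i →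
      |P.real (s ∩ (fun ω => R.X (n + K) ω 0) ⁻¹' B) - P.real s * A.target.real B| ≤
        (1 - β) ^ K * P.real s + K * (ε' * P.real s + P.real (s ∩ D)) := by
    intro I hI
    induction I, hI using Set.Finite.induction_on with
    | empty =>
      intro _ s _ hs
      have : s = ∅ := by simpa using hs
      simp [this]
    | @insert i I _ _ ih =>
      intro hI s hs hsU
      have hit : i ∈ t ×ˢ Set.Icc 1 L := hI (Set.mem_insert _ _)
      have h1 := ih ((Set.subset_insert _ _).trans hI) (s \ U i) (hs.diff (hUm i))
        (fun ω hω => by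
          have := hsU hω.1
          simp only [Set.mem_iUnion, Set.mem_insert_iff, exists_prop] at this ⊢
          obtain ⟨j, rfl | hj, h⟩ := this
          · exact absurd h hω.2
          · exact ⟨j, hj, h⟩)
      have h2 := abs_real_inter_sub_target_le hA hR hpar' hX hβ0.le hβ1 hit.2.1 hit.2.2
        (hts hit.1).1 (hts hit.1).2 (hx₀ 0) (hβ i.2 i.1 (hts hit.1).1 (x₀ 0)) (K := K)
        (hs.inter (hUm i)) hDm (show 0 ≤ ε' by positivity)
        (fun ω hω hωD k hk => by
          have hωD' : dist (R.par (n + k) ω) (R.par n ω) < δ / 2 ∧ R.N (n + k) ω = R.N n ω := by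
            by_contra hcon
            refine hωD ⟨k, hk, ?_⟩
            by_contra hcon'
            push Not at hcon'
            exact hcon hcon'
          refine ⟨hωD'.2.trans hω.2.2, fun hp x hx C hC =>
            hclose i.2 hit.2.2 _ hp _ (hts hit.1).1 ?_ x hx C hC⟩
          calc dist (R.par (n + k) ω) i.1 ≤ dist (R.par (n + k) ω) (R.par n ω) +
                dist (R.par n ω) i.1 := dist_triangle _ _ _
            _ < δ / 2 + δ / 2 := add_lt_add hωD'.1 hω.2.1
            _ = δ := by ring) hB
      have hUm' : MeasurableSet (U i) := ℱ.le n _ (hUm i)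
      have split : ∀ C : Set Ω, P.real (s ∩ C) =
          P.real (s ∩ U i ∩ C) + P.real (s \ U i ∩ C) := fun C => by
        rw [← measureReal_inter_add_sdiff (s := s ∩ C) hUm', Set.inter_right_comm,
          Set.inter_sdiff_right_comm]
      have split' : P.real s = P.real (s ∩ U i) + P.real (s \ U i) :=
        (measureReal_inter_add_sdiff hUm').symm
      rw [split, split D, split', abs_le]
      rw [abs_le] at h1 h2
      constructor <;> linarith [h1.1, h1.2, h2.1, h2.2]
  set s : Set Ω := ⋃ i ∈ t ×ˢ Set.Icc 1 L, U i with hs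
  have hsm : MeasurableSet[ℱ n] s := hfin.measurableSet_biUnion fun i _ => hUm i
  have hs1 : ∀ᵐ ω ∂P, ω ∈ s := by
    filter_upwards [hpar, ae_N hR NeZero.one_le] with ω hp hN
    have := ht (⟨(hp n).1, (hp n).2⟩ : R.par n ω ∈ {θ ∈ A.params | θ.2 0 = 1})
    simp only [Set.mem_iUnion, exists_prop] at this
    obtain ⟨y, hy, hd⟩ := this
    exact Set.mem_biUnion (x := (y, R.N n ω)) ⟨hy, hN.2 n⟩ ⟨hd, rfl⟩
  have hs2 : ∀ C : Set Ω, P.real (s ∩ C) = P.real C := fun C =>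
    measureReal_congr (by
      filter_upwards [hs1] with ω hω
      exact propext (and_iff_right hω))
  have hs3 : P.real s = 1 := by
    rw [← Set.inter_univ s, hs2, probReal_univ]
  have h := key _ hfin subset_rfl s hsm subset_rfl
  rw [hs2, hs2, hs3, one_mul, mul_one, mul_one, mul_add] at h
  have := hn₀ n hn
  linarith

end Run

end AdaptivePT

theorem theorem4 {p L : ℕ} [NeZero L] (A : AdaptivePT.Spec p L) (hA : A.Conventions)
    -- the target: compact support, density continuous and positive on it
    (hS : IsCompact A.S) (hdens_cont : ContinuousOn A.dens A.S)
    (hdens_pos : ∀ x ∈ A.S, 0 < A.dens x) (hdens_zero : ∀ x ∉ A.S, A.dens x = 0)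
    (hdens_int : ∫ x, A.dens x = 1)
    -- the proposal densities: continuous and positive on `S² × Γ^p`
    (hq_cont : ContinuousOn
      (fun z : (AdaptivePT.E p × AdaptivePT.E p) × (Fin p → ℝ) => A.q z.2 z.1.1 z.1.2)
      ((A.S ×ˢ A.S) ×ˢ A.varBox))
    (hq_pos : ∀ γ ∈ A.varBox, ∀ x ∈ A.S, ∀ y ∈ A.S, 0 < A.q γ x y)
    -- arbitrary initial values
    (x₀ : Fin L → AdaptivePT.E p) (hx₀ : ∀ l, x₀ l ∈ A.S)
    (ζ₀ : Fin L → ℝ) (hζ₀ : ζ₀ 0 = 0) (hζ₀' : ∀ l, l ≠ 0 → Real.exp (ζ₀ l) ∈ A.T)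
    (γ₀ : Fin L → Fin p → ℝ) (hγ₀ : ∀ l, γ₀ l ∈ A.varBox) (μ₀ : Fin L → Fin p → ℝ)
    -- any realisation of the algorithm from these initial values
    {Ω : Type*} [MeasurableSpace Ω] (P : Measure Ω) [IsProbabilityMeasure P]
    (ℱ : Filtration ℕ (inferInstance : MeasurableSpace Ω)) (R : AdaptivePT.Run p L Ω)
    (hR : R.IsAdaptivePT A P ℱ x₀ ζ₀ γ₀ μ₀) :
    Tendsto (fun n => AdaptivePT.tvDist (P.map fun ω => R.X n ω 0) A.target) atTop (𝓝 0) := by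
  have hreg : A.Regular := ⟨hA, hS, hdens_cont, hdens_pos, hdens_zero, hdens_int, hq_cont, hq_pos⟩
  -- The uniform bound is taken with `ε / 2`, since a supremum preserves only non-strict
  -- inequalities.
  refine Metric.tendsto_nhds.2 fun ε hε => ?_
  filter_upwards [AdaptivePT.Run.eventually_abs_real_sub_target_le hreg hR hx₀ hζ₀ hζ₀' hγ₀
    (half_pos hε)] with n hn
  have hXm : Measurable fun ω => R.X n ω 0 :=
    (measurable_pi_apply 0).comp ((hR.X_meas n).mono (ℱ.le n) le_rfl)
  rw [Real.dist_0_eq_abs, AdaptivePT.tvDist, abs_of_nonneg (Real.iSup_nonneg fun _ => abs_nonneg _)]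
  refine (Real.iSup_le (fun B => ?_) (half_pos hε).le).trans_lt (half_lt_self hε)
  rw [map_measureReal_apply hXm B.2]
  exact hn B.1 B.2
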